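/- Let $\Sigma$ be a finite, non-empty, totally ordered alphabet and $w\ge 1$. A $(\Sigma,w)$-layer is a tuple $(\ell,r,T,I,F,\iota,\phi)$ with left states $\ell\subseteq\{0,\dots,w-1\}$, right states $r\subseteq\{0,\dots,w-1\}$, transitions $T\subseteq \ell\times\Sigma\times r$, initial states $I\subseteq \ell$, final states $F\subseteq r$ and Boolean flags $\iota,\phi$ such that $I=\emptyset$ if $\iota=0$ and $F=\emptyset$ if $\phi=0$. A $(\Sigma,w)$-ODD of length $k\ge 1$ is a string $D=L_1\cdots L_k$ of $(\Sigma,w)$-layers with $\ell(L_{i+1})=r(L_i)$ for $1\le i<k$, with $\iota(L_i)=1$ exactly for $i=1$, and with $\phi(L_i)=1$ exactly for $i=k$. It accepts $a_1\cdots a_k\in\Sigma^k$ if there are states $q_0,\dots,q_k$ with $q_0\in I(L_1)$, $q_k\in F(L_k)$ and $(q_{i-1},a_i,q_i)\in T(L_i)$ for all $1\le i\le k$; its language $\mathcal L(D)$ is the pair of $k$ and the set of accepted strings. The width of $D$ is $\max\{|\ell(L_1)|,\dots,|\ell(L_k)|,|r(L_k)|\}$, its number of states is $|\ell(L_1)|+\sum_{i=1}^k|r(L_i)|$,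 and its number of transitions is $\sum_{i=1}^k|T(L_i)|$. For a set $S$ of $(\Sigma,w)$-layers, let $S^{\circ k}$ be the set of ODDs of length $k$ all of whose layers are in $S$, and $S^{\circledast}=\bigcup_{k\ge1}S^{\circ k}$. There are four algorithms, each uniform in all the data, with the following properties for every $\Sigma$, $w\ge1$, $k\ge1$, every $(\Sigma,w)$-ODD $D$ of length $k$ and every set $S$ of $(\Sigma,w)$-layers. The input consists of $|\Sigma|$, $w$, $D$ and a list, in any order and without repetition, of the elements of $S$. The constants hidden in $O(\cdot)$ are absolute. Time is the number of elementary steps (building a cell, following a pointer, testing for nil, accessing a variable, branching, binding a variable, calling a function) of a first-order recursive program on binary trees. The first algorithm decides in time $2^{O(|\Sigma|\cdot w\cdot 2^w)}\cdot k$ whether there is $D'\in S^{\circ k}$ with $\mathcal L(D')=\mathcal L(D)$. Whenever such a $D'$ exists: 1. the second algorithm constructs in time $2^{O(|\Sigma|\cdot w\cdot 2^w)}\cdot k$ an ODD of minimum width among all $D'\in S^{\circledast}$ with $\mathcal L(D')=\mathcal L(D)$; 2. the third algorithm constructs in time $2^{O(|\Sigma|\cdot w\cdot 2^w)}\cdot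 k^2\lfloor\log_2(k+1)\rfloor$ an ODD with minimum number of states among all $D'\in S^{\circledast}$ with $\mathcal L(D')=\mathcal L(D)$; 3. the fourth algorithm constructs in time $2^{O(|\Sigma|\cdot w\cdot 2^w)}\cdot k^2\lfloor\log_2(k+1)\rfloor$ an ODD with minimum number of transitions among all $D'\in S^{\circledast}$ with $\mathcal L(D')=\mathcal L(D)$. -/

import Mathlib

universe u

namespace ODD

/-! ### Layers and ordered decision diagrams -/

/-- A layer of width at most `w` over the alphabet `α`; its states are elements of
`{0, …, w - 1}`. -/
@[ext]
structure Layer (α : Type*) (w : ℕ) where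
  /-- left states -/
  left : Finset (Fin w)
  /-- right states -/
  right : Finset (Fin w)
  /-- transitions -/
  trans : Finset (Fin w × α × Fin w)
  /-- initial states -/
  init : Finset (Fin w)
  /-- final states -/
  fin : Finset (Fin w)
  initFlag : Bool
  finFlag : Bool
  trans_sub : ∀ e ∈ trans, e.1 ∈ left ∧ e.2.2 ∈ right
  init_sub : init ⊆ left
  fin_sub : fin ⊆ right
  init_flag : initFlag = false → init = ∅
  fin_flag : finFlag = false → fin = ∅

/-- A nonempty string of layers is an ordered decision diagram when consecutive layers share
their frontier, exactly the first layer has its initial flag set, and exactly the last layer has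
its final flag set. -/
structure IsODD {α : Type*} {w : ℕ} (D : List (Layer α w)) : Prop where
  ne_nil : D ≠ []
  frontier : D.IsChain (fun L L' => L'.left = L.right)
  initFlag : ∀ (i : ℕ) (h : i < D.length), D[i].initFlag = true ↔ i = 0
  finFlag : ∀ (i : ℕ) (h : i < D.length), D[i].finFlag = true ↔ i + 1 = D.length

/-- The ordered decision diagrams of length `k` all of whose layers belong to `S`. -/
def oddsOfLength {α : Type*} {w : ℕ} (S : Set (Layer α w)) (k : ℕ) : Set (List (Layer α w)) :=
  {D | IsODD D ∧ D.length = k ∧ ∀ L ∈ D, L ∈ S}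

/-- The ordered decision diagrams, of any length, all of whose layers belong to `S`. -/
def odds {α : Type*} {w : ℕ} (S : Set (Layer α w)) : Set (List (Layer α w)) :=
  {D | ∃ k : ℕ, 0 < k ∧ D ∈ oddsOfLength S k}

/-- `r` is an accepting sequence of transitions for the string `s` in `D`. -/
structure IsAccepting {α : Type*} {w : ℕ} (D : List (Layer α w)) (s : List α)
    (r : List (Fin w × α × Fin w)) : Prop where
  trans : List.Forall₂ (fun e L => e ∈ L.trans) r D
  letters : r.map (fun e => e.2.1) = s
  linked : r.IsChain (fun e e' => e'.1 = e.2.2)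
  initial : ∃ e ∈ r.head?, ∃ L ∈ D.head?, e.1 ∈ L.init
  final : ∃ e ∈ r.getLast?, ∃ L ∈ D.getLast?, e.2.2 ∈ L.fin

/-- The language of `D`, as a set of strings typed with their length. -/
def lang {α : Type*} {w : ℕ} (D : List (Layer α w)) : ℕ × Set (List α) :=
  (D.length, {s | ∃ r, IsAccepting D s r})

/-- The width: the maximum size of a left frontier or of the last right frontier. -/
def width {α : Type*} {w : ℕ} (D : List (Layer α w)) : ℕ :=
  max ((D.map fun L => L.left.card).foldr max 0) ((D.getLast?.map fun L => L.right.card).getD 0)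

/-- The number of states: the first left frontier together with all right frontiers. -/
def numStates {α : Type*} {w : ℕ} (D : List (Layer α w)) : ℕ :=
  (D.head?.map fun L => L.left.card).getD 0 + (D.map fun L => L.right.card).sum

/-- The number of transitions. -/
def numTransitions {α : Type*} {w : ℕ} (D : List (Layer α w)) : ℕ :=
  (D.map fun L => L.trans.card).sum

/-- Among the diagrams with layers in `S` and the same language as `D`, the diagram `D'` minimizes
the measure `μ`. -/
def IsMinimizer {α : Type*} {w : ℕ} (μ : List (Layer α w) → ℕ) (S : Set (Layer α w))
    (D D' : List (Layer α w)) : Prop :=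
  D' ∈ odds S ∧ lang D' = lang D ∧ ∀ D'' ∈ odds S, lang D'' = lang D → μ D' ≤ μ D''

/-! ### The model of computation

Algorithms are first-order recursive programs manipulating binary trees of pointers: the only
primitive operations are building a cell, following one of its two pointers, and testing
whether a pointer is `nil`. There is no arithmetic: numbers have to be represented by trees and
computed with cell by cell. A program is a finite list of functions, each with one argument. -/

/-- Data: binary trees. -/
inductive Data where
  | nil : Data
  | cons (a b : Data) : Data

namespace Data

/-- The left component (`nil` has none, and yields `nil`). -/
def fst : Data → Data
  | nil => nil
  | cons a _ => a

/-- The right component (`nil` has none, and yields `nil`). -/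
def snd : Data → Data
  | nil => nil
  | cons _ b => b

/-- Truth values as data. -/
def ofBool : Bool → Data
  | false => nil
  | true => cons nil nil

/-- Lists as data. -/
def ofList : List Data → Data
  | [] => nil
  | a :: l => cons a (ofList l)

/-- Natural numbers in unary as data. -/
def ofNat (n : ℕ) : Data := ofList (List.replicate n nil)

end Data

/-- Expressions. The variable `var i` refers to the `i`-th innermost binding, the outermost
binding being the argument of the function whose body is evaluated. -/
inductive Expr where
  | var (i : ℕ) : Expr
  | nil : Expr
  | cons (a b : Expr) : Expr
  | fst (a : Expr) : Expr
  | snd (a : Expr) : Expr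
  /-- `ite c a b` evaluates `a` if `c` evaluates to a cell, and `b` if `c` evaluates to `nil` -/
  | ite (c a b : Expr) : Expr
  /-- evaluates `b` with the value of `a` as its innermost binding -/
  | letIn (a b : Expr) : Expr
  /-- calls function number `f` of the program on the value of `a` -/
  | call (f : ℕ) (a : Expr) : Expr

/-- A program is a finite list of function bodies; function number `0` is its entry point. -/
abbrev Program := List Expr

/-- `Eval P env e v t`: in the program `P`, with the bindings `env`, the expression `e` evaluates
to `v` in exactly `t` steps (call by value; every evaluation of a node of an expression is one
step). An expression whose evaluation does not terminate has no value. -/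
inductive Eval (P : Program) : List Data → Expr → Data → ℕ → Prop
  | var (env : List Data) (i : ℕ) : Eval P env (.var i) (env.getD i .nil) 1
  | nil (env : List Data) : Eval P env .nil .nil 1
  | cons {env : List Data} {a b : Expr} {u v : Data} {s t : ℕ} :
      Eval P env a u s → Eval P env b v t → Eval P env (.cons a b) (.cons u v) (s + t + 1)
  | fst {env : List Data} {a : Expr} {u : Data} {s : ℕ} :
      Eval P env a u s → Eval P env (.fst a) u.fst (s + 1)
  | snd {env : List Data} {a : Expr} {u : Data} {s : ℕ} :
      Eval P env a u s → Eval P env (.snd a) u.snd (s + 1)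
  | iteCons {env : List Data} {c a b : Expr} {x y v : Data} {s t : ℕ} :
      Eval P env c (.cons x y) s → Eval P env a v t → Eval P env (.ite c a b) v (s + t + 1)
  | iteNil {env : List Data} {c a b : Expr} {v : Data} {s t : ℕ} :
      Eval P env c .nil s → Eval P env b v t → Eval P env (.ite c a b) v (s + t + 1)
  | letIn {env : List Data} {a b : Expr} {u v : Data} {s t : ℕ} :
      Eval P env a u s → Eval P (u :: env) b v t → Eval P env (.letIn a b) v (s + t + 1)
  | call {env : List Data} {f : ℕ} {a : Expr} {u v : Data} {s t : ℕ} :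
      Eval P env a u s → Eval P [u] (P.getD f .nil) v t → Eval P env (.call f a) v (s + t + 1)

/-- Evaluation is deterministic: both the value and the number of steps are unique. -/
theorem Eval.unique {P : Program} {env : List Data} {e : Expr} {v v' : Data} {t t' : ℕ}
    (h : Eval P env e v t) (h' : Eval P env e v' t') : v = v' ∧ t = t' := by
  induction h generalizing v' t' with
  | var env i => cases h'; exact ⟨rfl, rfl⟩
  | nil env => cases h'; exact ⟨rfl, rfl⟩
  | cons _ _ ih₁ ih₂ =>
    cases h' with
    | cons h₁ h₂ =>
      obtain ⟨rfl, rfl⟩ := ih₁ h₁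
      obtain ⟨rfl, rfl⟩ := ih₂ h₂
      exact ⟨rfl, rfl⟩
  | fst _ ih => cases h' with | fst h₁ => obtain ⟨rfl, rfl⟩ := ih h₁; exact ⟨rfl, rfl⟩
  | snd _ ih => cases h' with | snd h₁ => obtain ⟨rfl, rfl⟩ := ih h₁; exact ⟨rfl, rfl⟩
  | iteCons _ _ ih₁ ih₂ =>
    cases h' with
    | iteCons h₁ h₂ =>
      obtain ⟨_, rfl⟩ := ih₁ h₁
      obtain ⟨rfl, rfl⟩ := ih₂ h₂
      exact ⟨rfl, rfl⟩
    | iteNil h₁ h₂ => exact absurd (ih₁ h₁).1 (by simp)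
  | iteNil _ _ ih₁ ih₂ =>
    cases h' with
    | iteCons h₁ h₂ => exact absurd (ih₁ h₁).1 (by simp)
    | iteNil h₁ h₂ =>
      obtain ⟨_, rfl⟩ := ih₁ h₁
      obtain ⟨rfl, rfl⟩ := ih₂ h₂
      exact ⟨rfl, rfl⟩
  | letIn _ _ ih₁ ih₂ =>
    cases h' with
    | letIn h₁ h₂ =>
      obtain ⟨rfl, rfl⟩ := ih₁ h₁
      obtain ⟨rfl, rfl⟩ := ih₂ h₂
      exact ⟨rfl, rfl⟩
  | call _ _ ih₁ ih₂ =>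
    cases h' with
    | call h₁ h₂ =>
      obtain ⟨rfl, rfl⟩ := ih₁ h₁
      obtain ⟨rfl, rfl⟩ := ih₂ h₂
      exact ⟨rfl, rfl⟩

/-- On input `x`, the program `P` terminates within `T` steps with output `y`. -/
def Program.OutputsWithin (P : Program) (x y : Data) (T : ℕ) : Prop :=
  ∃ t ≤ T, Eval P [x] (P.getD 0 .nil) y t

/-! ### Encoding of layers, diagrams and inputs -/

/-- The letters of a finite ordered alphabet, in increasing order. -/
def letters (α : Type*) [Fintype α] [LinearOrder α] : List α :=
  (Finset.univ : Finset α).sort (· ≤ ·)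

/-- A set of states, as its list of `w` membership bits. -/
def encodeStates {w : ℕ} (A : Finset (Fin w)) : Data :=
  .ofList ((List.finRange w).map fun p => .ofBool (decide (p ∈ A)))

/-- A set of transitions, as its `w × |α| × w` table of membership bits. -/
def encodeTransitions {α : Type*} [Fintype α] [LinearOrder α] {w : ℕ}
    (T : Finset (Fin w × α × Fin w)) : Data :=
  .ofList ((List.finRange w).map fun p =>
    .ofList ((letters α).map fun a =>
      .ofList ((List.finRange w).map fun q => .ofBool (decide ((p, a, q) ∈ T)))))

/-- A layer, as the list of its seven components. -/
def encodeLayer {α : Type*} [Fintype α] [LinearOrder α] {w : ℕ} (L : Layer α w) : Data :=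
  .ofList [encodeStates L.left, encodeStates L.right, encodeTransitions L.trans,
    encodeStates L.init, encodeStates L.fin, .ofBool L.initFlag, .ofBool L.finFlag]

/-- A string of layers, in particular an ordered decision diagram. -/
def encodeLayers {α : Type*} [Fintype α] [LinearOrder α] {w : ℕ} (D : List (Layer α w)) : Data :=
  .ofList (D.map encodeLayer)

/-- The input of the algorithms: the size of the alphabet, the bound `w`, a diagram `D`, and a
list `l` of layers. -/
def encodeInput {α : Type*} [Fintype α] [LinearOrder α] {w : ℕ} (D l : List (Layer α w)) : Data :=
  .ofList [.ofNat (Fintype.card α), .ofNat w, encodeLayers D, encodeLayers l]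

/-- The list `l` presents the set of layers `S`: it lists the elements of `S`, in any order,
without repetition. -/
def Presents {α : Type*} {w : ℕ} (l : List (Layer α w)) (S : Set (Layer α w)) : Prop :=
  l.Nodup ∧ ∀ L, L ∈ l ↔ L ∈ S

end ODD

namespace ODD

/-! ### Evaluation within a number of steps -/

/-! The algorithm is a dynamic program that reads `D` from its last layer to its first. For each
suffix of `D`, consider the strings `c` of layers from `S` that could stand in its place (`Valid`).
After determinization by sets of states, all that the layers in front can notice of `c` is its
`key`: the left frontier, the initial states, and the relation of those pairs (A, B) such that A
accepts in the suffix of `D` exactly what B accepts in `c`. By `rlang_cons_eq_iff` this relation in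
front of a layer is computed letter by letter from the one behind it. Hence a string can be
exchanged for any other with the same key (`Fits.congr`, `key_cons_congr`). On diagrams each of the
three measures is a fold of a step monotone in the accumulated weight, so one lightest string per
key is enough (`exists_le_solve`), and equality with the language of `D` is read off the keys at the
end (`solution_eq_some`, `solution_eq_none`). Since a language records its length, minimizing over
all lengths is minimizing over length `k`.

The running time rests on the number of keys. There are 2^(4^w) relations between sets of states,
far too many. But with the suffix of `D` fixed, the partners A of a set B are either none or a full
class of sets with the same right language in that suffix, and such a class is named by any of its
members. This leaves at most (2^w + 1)^(2^w) relations (`length_le_keyCount`), so that there are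
2^O(w * 2^w) keys. There are 2^O(|Σ| * w^2) layers (`length_layers_le`), so apart from arithmetic on
weights each layer of `D` costs 2^O(|Σ| * w * 2^w) steps.

Weights are unary numbers. A width is at most `w` and disappears in the constant; numbers of states
and transitions are linear in `k`, which is where the second factor `k` comes from. The logarithm is
not needed: it is only used as a number that is at least 1.

The lemmas `calls_…` connect the program with this mathematics: each gives the value of one function
and a bound on its steps, of the form constant times length plus one for a recursion over a list. -/

/-- In the program `P`, with the bindings `env`, the expression `e` evaluates to `v` in at most
`T` steps. -/
def Within (P : Program) (env : List Data) (e : Expr) (v : Data) (T : ℕ) : Prop :=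
  ∃ t ≤ T, Eval P env e v t

/-- Function number `f` of the program `P` maps `x` to `v` in at most `T` steps. -/
def Calls (P : Program) (f : ℕ) (x v : Data) (T : ℕ) : Prop :=
  Within P [x] (P.getD f .nil) v T

namespace Within

variable {P : Program} {env : List Data} {a b c : Expr} {u v x y v' : Data} {s t T i f : ℕ}

/-- Derivations follow the syntax of a function body and leave value and bound to unification; this
lemma then adjusts both at once. Giving `a` as the body makes the lookup in the program hold by
definition. -/
theorem conv (h : Within P env a v t) (hv : v = v') (ht : t ≤ T) : Within P env a v' T := by
  obtain ⟨r, hr, h⟩ := h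
  exact ⟨r, hr.trans ht, hv ▸ h⟩

theorem var : Within P env (.var i) (env.getD i .nil) 1 := ⟨1, le_rfl, .var env i⟩

theorem nil : Within P env .nil .nil 1 := ⟨1, le_rfl, .nil env⟩

theorem cons (h : Within P env a u s) (h' : Within P env b v t) :
    Within P env (.cons a b) (.cons u v) (s + t + 1) := by
  obtain ⟨r, hr, h⟩ := h
  obtain ⟨r', hr', h'⟩ := h'
  exact ⟨r + r' + 1, by omega, .cons h h'⟩

theorem fst (h : Within P env a u s) : Within P env (.fst a) u.fst (s + 1) := by
  obtain ⟨r, hr, h⟩ := h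
  exact ⟨r + 1, by omega, .fst h⟩

theorem snd (h : Within P env a u s) : Within P env (.snd a) u.snd (s + 1) := by
  obtain ⟨r, hr, h⟩ := h
  exact ⟨r + 1, by omega, .snd h⟩

theorem iteCons (h : Within P env c u s) (hu : u = .cons x y) (h' : Within P env a v t) :
    Within P env (.ite c a b) v (s + t + 1) := by
  subst hu
  obtain ⟨r, hr, h⟩ := h
  obtain ⟨r', hr', h'⟩ := h'
  exact ⟨r + r' + 1, by omega, .iteCons h h'⟩

theorem iteNil (h : Within P env c u s) (hu : u = .nil) (h' : Within P env b v t) :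
    Within P env (.ite c a b) v (s + t + 1) := by
  subst hu
  obtain ⟨r, hr, h⟩ := h
  obtain ⟨r', hr', h'⟩ := h'
  exact ⟨r + r' + 1, by omega, .iteNil h h'⟩

/-- Keeps both branches in one derivation: the value becomes an `if` and the cost a `max`, so that
case distinctions can wait until values are compared. -/
theorem iteBool {q : Bool} {s t t' : ℕ} (h : Within P env c u s) (hu : u = .ofBool q)
    (h₁ : q = true → Within P env a v t) (h₂ : q = false → Within P env b v' t') :
    Within P env (.ite c a b) (if q then v else v') (s + max t t' + 1) := by
  subst hu
  cases q
  · exact (iteNil h rfl (h₂ rfl)).conv (by simp) (by omega)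
  · exact (iteCons h rfl (h₁ rfl)).conv (by simp) (by omega)

theorem letIn (h : Within P env a u s) (h' : Within P (u :: env) b v t) :
    Within P env (.letIn a b) v (s + t + 1) := by
  obtain ⟨r, hr, h⟩ := h
  obtain ⟨r', hr', h'⟩ := h'
  exact ⟨r + r' + 1, by omega, .letIn h h'⟩

theorem call (h : Within P env a u s) (h' : Calls P f u v t) :
    Within P env (.call f a) v (s + t + 1) := by
  obtain ⟨r, hr, h⟩ := h
  obtain ⟨r', hr', h'⟩ := h'
  exact ⟨r + r' + 1, by omega, .call h h'⟩

theorem one : Within P env (.cons .nil .nil) (.ofBool true) 3 := cons nil nil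

end Within

theorem Calls.conv {P : Program} {f : ℕ} {x v v' : Data} {t T : ℕ} (h : Calls P f x v t)
    (hv : v = v') (ht : t ≤ T) : Calls P f x v' T :=
  Within.conv h hv ht

/-- The number of nodes of a tree. -/
def Data.size : Data → ℕ
  | .nil => 1
  | .cons a b => a.size + b.size + 1

/-! ### The program -/

namespace Prog

/-- The truth value `true`. -/
abbrev one : Expr := .cons .nil .nil

/-- The argument of the current function. -/
abbrev arg : Expr := .var 0

abbrev fEq : ℕ := 1
abbrev fOr : ℕ := 2
abbrev fOrRows : ℕ := 3
abbrev fSucc : ℕ := 4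
abbrev fMeets : ℕ := 5
abbrev fMem : ℕ := 6
abbrev fCheck : ℕ := 7
abbrev fFilter : ℕ := 8
abbrev fLe : ℕ := 9
abbrev fInsert : ℕ := 10
abbrev fLayers : ℕ := 11
abbrev fConfigs : ℕ := 12
abbrev fSolve : ℕ := 13
abbrev fSubsets : ℕ := 14
abbrev fExtend : ℕ := 15
abbrev fPairWith : ℕ := 16
abbrev fPairs : ℕ := 17
abbrev fReplicate : ℕ := 18
abbrev fBest : ℕ := 19
abbrev fWeight : ℕ := 20
abbrev fCount : ℕ := 21
abbrev fCountRows : ℕ := 22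
abbrev fCountTable : ℕ := 23
abbrev fMax : ℕ := 24

/-- Equality of trees; the argument is `(x, y)`. -/
def eqBody : Expr :=
  .ite (.fst arg)
    (.ite (.snd arg)
      (.ite (.call fEq (.cons (.fst (.fst arg)) (.fst (.snd arg))))
        (.call fEq (.cons (.snd (.fst arg)) (.snd (.snd arg)))) .nil)
      .nil)
    (.ite (.snd arg) .nil one)

/-- Bitwise disjunction of two lists of bits. -/
def orBody : Expr :=
  .ite (.fst arg)
    (.cons (.ite (.fst (.fst arg)) one (.fst (.snd arg)))
      (.call fOr (.cons (.snd (.fst arg)) (.snd (.snd arg)))))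
    .nil

/-- Bitwise disjunction of two lists of lists of bits. -/
def orRowsBody : Expr :=
  .ite (.fst arg)
    (.cons (.call fOr (.cons (.fst (.fst arg)) (.fst (.snd arg))))
      (.call fOrRows (.cons (.snd (.fst arg)) (.snd (.snd arg)))))
    .nil

/-- The sets of successors of a set of states, for all letters; the argument is `(z, A, T)` with
`z` the result for the empty set, `A` the set and `T` the table of transitions. -/
def succBody : Expr :=
  .ite (.fst (.snd arg))
    (.letIn
      (.call fSucc (.cons (.fst arg)
        (.cons (.snd (.fst (.snd arg))) (.snd (.snd (.snd arg))))))
      (.ite (.fst (.fst (.snd (.var 1))))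
        (.call fOrRows (.cons (.fst (.snd (.snd (.var 1)))) (.var 0)))
        (.var 0)))
    (.fst arg)

/-- Whether two sets of states meet. -/
def meetsBody : Expr :=
  .ite (.fst arg)
    (.ite (.fst (.fst arg))
      (.ite (.fst (.snd arg)) one
        (.call fMeets (.cons (.snd (.fst arg)) (.snd (.snd arg)))))
      (.call fMeets (.cons (.snd (.fst arg)) (.snd (.snd arg)))))
    .nil

/-- Membership in a list. -/
def memBody : Expr :=
  .ite (.snd arg)
    (.ite (.call fEq (.cons (.fst arg) (.fst (.snd arg)))) one
      (.call fMem (.cons (.fst arg) (.snd (.snd arg)))))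
    .nil

/-- Whether all letters lead to equivalent sets; the argument is `((φ, (F, F'), E), (s, s'))` with
`s` and `s'` the lists of successor sets, `E` the equivalent pairs behind a layer that is not the
last one, and `F`, `F'` the final states in a last layer. -/
def checkBody : Expr :=
  .ite (.fst (.snd arg))
    (.ite
      (.ite (.fst (.fst arg))
        (.call fEq (.cons
          (.call fMeets (.cons (.fst (.fst (.snd arg))) (.fst (.fst (.snd (.fst arg))))))
          (.call fMeets (.cons (.fst (.snd (.snd arg))) (.snd (.fst (.snd (.fst arg))))))))
        (.call fMem (.cons (.cons (.fst (.fst (.snd arg))) (.fst (.snd (.snd arg))))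
          (.snd (.snd (.fst arg))))))
      (.call fCheck (.cons (.fst arg)
        (.cons (.snd (.fst (.snd arg))) (.snd (.snd (.snd arg))))))
      .nil)
    one

/-- The pairs of equivalent sets among the given ones; the argument is
`((z, (T, T'), χ), pairs)`. -/
def filterBody : Expr :=
  .ite (.snd arg)
    (.letIn (.call fFilter (.cons (.fst arg) (.snd (.snd arg))))
      (.ite
        (.call fCheck (.cons (.snd (.snd (.fst (.var 1))))
          (.cons
            (.call fSucc (.cons (.fst (.fst (.var 1)))
              (.cons (.fst (.fst (.snd (.var 1)))) (.fst (.fst (.snd (.fst (.var 1))))))))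
            (.call fSucc (.cons (.fst (.fst (.var 1)))
              (.cons (.snd (.fst (.snd (.var 1)))) (.snd (.fst (.snd (.fst (.var 1)))))))))))
        (.cons (.fst (.snd (.var 1))) (.var 0))
        (.var 0)))
    .nil

/-- Comparison of unary numbers. -/
def leBody : Expr :=
  .ite (.fst arg)
    (.ite (.snd arg) (.call fLe (.cons (.snd (.fst arg)) (.snd (.snd arg)))) .nil)
    one

/-- Insertion of a configuration `(key, weight, path)` into a list of them that keeps the lightest
one for each key. -/
def insertBody : Expr :=
  .ite (.snd arg)
    (.ite (.call fEq (.cons (.fst (.fst arg)) (.fst (.fst (.snd arg)))))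
      (.ite (.call fLe (.cons (.fst (.snd (.fst arg))) (.fst (.snd (.fst (.snd arg))))))
        (.cons (.fst arg) (.snd (.snd arg)))
        (.snd arg))
      (.cons (.fst (.snd arg)) (.call fInsert (.cons (.fst arg) (.snd (.snd arg))))))
    (.cons (.fst arg) .nil)

/-- Component number `i` of a layer. -/
def comp (e : Expr) : ℕ → Expr
  | 0 => .fst e
  | i + 1 => comp (.snd e) i

/-- Extension of the configuration `c` by all fitting layers from a list, inserted into `acc`; the
argument is `(((z, pairs), L, c), layers, acc)`. -/
def layersBody : Expr :=
  let z : Expr := .fst (.fst (.fst (.var 1)))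
  let pairs : Expr := .snd (.fst (.fst (.var 1)))
  let L : Expr := .fst (.snd (.fst (.var 1)))
  let c : Expr := .snd (.snd (.fst (.var 1)))
  let L' : Expr := .fst (.fst (.snd (.var 1)))
  .ite (.fst (.snd arg))
    (.letIn
      (.call fLayers (.cons (.fst arg)
        (.cons (.snd (.fst (.snd arg))) (.snd (.snd arg)))))
      (.ite (.call fEq (.cons (comp L 5) (comp L' 5)))
        (.ite (.call fEq (.cons (comp L 6) (comp L' 6)))
          (.ite (.ite (comp L 6) one (.call fEq (.cons (comp L' 1) (.fst (.fst c)))))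
            (.call fInsert (.cons
              (.cons
                (.cons (comp L' 0) (.cons (comp L' 3)
                  (.call fFilter (.cons
                    (.cons z (.cons (.cons (comp L 2) (comp L' 2))
                      (.cons (comp L 6) (.cons (.cons (comp L 4) (comp L' 4))
                        (.snd (.snd (.fst c)))))))
                    pairs))))
                (.cons (.call fWeight (.cons L' (.fst (.snd c)))) (.cons L' (.snd (.snd c)))))
              (.var 0)))
            (.var 0))
          (.var 0))
        (.var 0)))
    (.snd (.snd arg))

/-- Extension of all configurations of a list by all fitting layers; the argument is
`(((z, pairs), L, layers), configurations)`. -/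
def configsBody : Expr :=
  .ite (.snd arg)
    (.call fLayers (.cons
      (.cons (.fst (.fst arg)) (.cons (.fst (.snd (.fst arg))) (.fst (.snd arg))))
      (.cons (.snd (.snd (.fst arg))) (.call fConfigs (.cons (.fst arg) (.snd (.snd arg)))))))
    .nil

/-- The configurations for a diagram; the argument is `(((z, pairs), layers), D)`. -/
def solveBody : Expr :=
  .ite (.snd arg)
    (.call fConfigs (.cons
      (.cons (.fst (.fst arg)) (.cons (.fst (.snd arg)) (.snd (.fst arg))))
      (.call fSolve (.cons (.fst arg) (.snd (.snd arg))))))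
    (.cons (.cons .nil (.cons .nil .nil)) .nil)

/-- All lists of bits of a length given in unary. -/
def subsetsBody : Expr :=
  .ite arg (.call fExtend (.call fSubsets (.snd arg))) (.cons .nil .nil)

/-- All extensions of the lists in a list by one bit. -/
def extendBody : Expr :=
  .ite arg
    (.cons (.cons .nil (.fst arg)) (.cons (.cons one (.fst arg)) (.call fExtend (.snd arg))))
    .nil

/-- The pairs of `a` with the elements of `l`, in front of `acc`; the argument is `(a, l, acc)`. -/
def pairWithBody : Expr :=
  .ite (.fst (.snd arg))
    (.cons (.cons (.fst arg) (.fst (.fst (.snd arg))))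
      (.call fPairWith (.cons (.fst arg) (.cons (.snd (.fst (.snd arg))) (.snd (.snd arg))))))
    (.snd (.snd arg))

/-- All pairs of elements of two lists. -/
def pairsBody : Expr :=
  .ite (.fst arg)
    (.call fPairWith (.cons (.fst (.fst arg)) (.cons (.snd arg)
      (.call fPairs (.cons (.snd (.fst arg)) (.snd arg))))))
    .nil

/-- A list of copies of a tree; the argument is `(n, x)` with `n` in unary. -/
def replicateBody : Expr :=
  .ite (.fst arg)
    (.cons (.snd arg) (.call fReplicate (.cons (.snd (.fst arg)) (.snd arg))))
    .nil

/-- The lightest configuration whose initial states are equivalent to given ones; the argument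
is `(I, configurations)`. -/
def bestBody : Expr :=
  .ite (.snd arg)
    (.letIn (.call fBest (.cons (.fst arg) (.snd (.snd arg))))
      (.ite
        (.call fMem (.cons
          (.cons (.fst (.var 1)) (.fst (.snd (.fst (.fst (.snd (.var 1)))))))
          (.snd (.snd (.fst (.fst (.snd (.var 1))))))))
        (.ite (.var 0)
          (.ite (.call fLe (.cons (.fst (.snd (.fst (.snd (.var 1))))) (.fst (.snd (.var 0)))))
            (.fst (.snd (.var 1))) (.var 0))
          (.fst (.snd (.var 1))))
        (.var 0)))
    .nil

/-- Adds the number of bits set in a list to a unary number. -/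
def countBody : Expr :=
  .ite (.fst arg)
    (.ite (.fst (.fst arg))
      (.cons .nil (.call fCount (.cons (.snd (.fst arg)) (.snd arg))))
      (.call fCount (.cons (.snd (.fst arg)) (.snd arg))))
    (.snd arg)

/-- Adds the number of bits set in a list of lists to a unary number. -/
def countRowsBody : Expr :=
  .ite (.fst arg)
    (.call fCount (.cons (.fst (.fst arg))
      (.call fCountRows (.cons (.snd (.fst arg)) (.snd arg)))))
    (.snd arg)

/-- Adds the number of bits set in a table to a unary number. -/
def countTableBody : Expr :=
  .ite (.fst arg)
    (.call fCountRows (.cons (.fst (.fst arg))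
      (.call fCountTable (.cons (.snd (.fst arg)) (.snd arg)))))
    (.snd arg)

/-- The maximum of two unary numbers. -/
def maxBody : Expr :=
  .ite (.call fLe arg) (.snd arg) (.fst arg)

/-- The diagram computed from the input. -/
def optimum : Expr :=
  .letIn (.call fReplicate (.cons (.fst arg) (.call fReplicate (.cons (.fst (.snd arg)) .nil))))
    (.letIn (.call fSubsets (.fst (.snd (.var 1))))
      (.snd (.snd (.call fBest (.cons
        (comp (.fst (.fst (.snd (.snd (.var 2))))) 3)
        (.call fSolve (.cons
          (.cons (.cons (.var 1) (.call fPairs (.cons (.var 0) (.var 0))))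
            (.fst (.snd (.snd (.snd (.var 2))))))
          (.fst (.snd (.snd (.var 2)))))))))))

end Prog

open Prog in
/-- The program with a given main function and a given function that updates the weight of a
configuration; the argument of the latter is `(L, weight)`. -/
def prog (main weight : Expr) : Program :=
  [main, eqBody, orBody, orRowsBody, succBody, meetsBody, memBody, checkBody, filterBody, leBody,
    insertBody, layersBody, configsBody, solveBody, subsetsBody, extendBody, pairWithBody,
    pairsBody, replicateBody, bestBody, weight, countBody, countRowsBody, countTableBody, maxBody]

end ODD

namespace ODD
open Prog
open scoped Classical

variable {m wt : Expr}

/-! ### Running times of the list functions -/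

/-- A list of bits as data. -/
def bits {ι : Type*} (f : ι → Bool) (qs : List ι) : Data :=
  .ofList (qs.map fun q => .ofBool (f q))

theorem Data.ofBool_inj {b c : Bool} : Data.ofBool b = Data.ofBool c ↔ b = c := by
  cases b <;> cases c <;> simp [Data.ofBool]

theorem Data.size_ofBool (b : Bool) : (Data.ofBool b).size ≤ 3 := by
  cases b <;> simp [Data.ofBool, Data.size]

theorem size_ofList_map_le {ι : Type*} (f : ι → Data) (C : ℕ) (l : List ι)
    (h : ∀ x ∈ l, (f x).size ≤ C) : (Data.ofList (l.map f)).size ≤ (C + 1) * l.length + 1 := by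
  induction l with
  | nil => simp [Data.ofList, Data.size]
  | cons a l ih =>
    have h₁ := ih fun x hx => h x (by simp [hx])
    have h₂ := h a (by simp)
    simp only [List.map_cons, Data.ofList, Data.size, List.length_cons, Nat.mul_succ]
    omega

theorem size_bits_le {ι : Type*} (f : ι → Bool) (qs : List ι) :
    (bits f qs).size ≤ 4 * qs.length + 1 :=
  size_ofList_map_le _ 3 qs fun _ _ => Data.size_ofBool _

/-- The comparison walks through both trees in parallel and never goes deeper than the first one, so
the bound does not involve `y`. -/
theorem calls_eq (x y : Data) :
    Calls (prog m wt) fEq (.cons x y) (.ofBool (decide (x = y))) (30 * x.size) := by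
  induction x generalizing y with
  | nil =>
    cases y with
    | nil =>
      exact Within.conv (a := eqBody) (.iteNil (.fst .var) rfl (.iteNil (.snd .var) rfl .one))
        (by simp) (by simp [Data.size])
    | cons c d =>
      exact Within.conv (a := eqBody) (.iteNil (.fst .var) rfl (.iteCons (.snd .var) rfl .nil))
        (by simp [Data.ofBool]) (by simp [Data.size])
  | cons a b iha ihb =>
    cases y with
    | nil =>
      exact Within.conv (a := eqBody) (.iteCons (.fst .var) rfl (.iteNil (.snd .var) rfl .nil))
        (by simp [Data.ofBool]) (by simp only [Data.size]; omega)
    | cons c d =>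
      exact Within.conv (a := eqBody)
        (.iteCons (.fst .var) rfl (.iteCons (.snd .var) rfl
          (.iteBool (.call (.cons (.fst (.fst .var)) (.fst (.snd .var))) (iha c)) rfl
            (fun _ => .call (.cons (.snd (.fst .var)) (.snd (.snd .var))) (ihb d))
            (fun _ => .nil))))
        (by by_cases h : a = c <;> simp [Data.ofBool, h]) (by simp only [Data.size]; omega)

theorem calls_or {ι : Type*} (f g : ι → Bool) (qs : List ι) :
    Calls (prog m wt) fOr (.cons (bits f qs) (bits g qs)) (bits (fun q => f q || g q) qs)
      (30 * (qs.length + 1)) := by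
  induction qs with
  | nil => exact Within.conv (a := orBody) (.iteNil (.fst .var) rfl .nil) rfl (by simp)
  | cons q qs ih =>
    exact Within.conv (a := orBody)
      (.iteCons (.fst .var) rfl (.cons
        (.iteBool (.fst (.fst .var)) rfl (fun _ => .one) (fun _ => .fst (.snd .var)))
        (.call (.cons (.snd (.fst .var)) (.snd (.snd .var))) ih)))
      (by cases h : f q <;> simp [bits, h, Data.ofList, Data.fst, Data.snd])
      (by simp only [List.length_cons]; omega)

theorem calls_orRows {ι κ : Type*} (F G : κ → ι → Bool) (qs : List ι) (as : List κ) :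
    Calls (prog m wt) fOrRows
      (.cons (.ofList (as.map fun a => bits (F a) qs)) (.ofList (as.map fun a => bits (G a) qs)))
      (.ofList (as.map fun a => bits (fun q => F a q || G a q) qs))
      ((30 * (qs.length + 1) + 30) * (as.length + 1)) := by
  induction as with
  | nil => exact Within.conv (a := orRowsBody) (.iteNil (.fst .var) rfl .nil) rfl (by simp)
  | cons a as ih =>
    exact Within.conv (a := orRowsBody)
      (.iteCons (.fst .var) rfl (.cons
        (.call (.cons (.fst (.fst .var)) (.fst (.snd .var))) (calls_or (F a) (G a) qs))
        (.call (.cons (.snd (.fst .var)) (.snd (.snd .var))) ih)))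
      rfl
      (by simp only [List.length_cons, Nat.mul_succ _ (as.length + 1)]; omega)

/-- Time to compute successor sets, for `w` states and `s` letters. -/
def tSucc (w s : ℕ) : ℕ := ((30 * (w + 1) + 30) * (s + 1) + 60) * (w + 1)

/-- The rows of the table are united over the members of the set. The table of empty sets that
starts the union also supplies the number of letters and of states, which the program cannot count
otherwise when there are no rows. -/
theorem calls_succ {ι κ : Type*} (A : ι → Bool) (T : ι → κ → ι → Bool) (qs : List ι)
    (as : List κ) (ps : List ι) :
    Calls (prog m wt) fSucc
      (.cons (.ofList (as.map fun _ => bits (fun _ => false) qs))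
        (.cons (bits A ps) (.ofList (ps.map fun p => .ofList (as.map fun a => bits (T p a) qs)))))
      (.ofList (as.map fun a => bits (fun q => ps.any fun p => A p && T p a q) qs))
      (((30 * (qs.length + 1) + 30) * (as.length + 1) + 60) * (ps.length + 1)) := by
  induction ps with
  | nil =>
    exact Within.conv (a := succBody) (.iteNil (.fst (.snd .var)) rfl (.fst .var)) rfl
      (by simp)
  | cons p ps ih =>
    exact Within.conv (a := succBody)
      (.iteCons (.fst (.snd .var)) rfl (.letIn
        (.call (.cons (.fst .var) (.cons (.snd (.fst (.snd .var))) (.snd (.snd (.snd .var))))) ih)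
        (.iteBool (.fst (.fst (.snd .var))) rfl
          (fun _ => .call (.cons (.fst (.snd (.snd .var))) .var)
            (calls_orRows (T p) (fun a q => ps.any fun p => A p && T p a q) qs as))
          (fun _ => .var))))
      (by cases h : A p <;> simp [h])
      (by simp only [List.length_cons, Nat.mul_succ _ (ps.length + 1)]; omega)

theorem calls_meets {ι : Type*} (f g : ι → Bool) (qs : List ι) :
    Calls (prog m wt) fMeets (.cons (bits f qs) (bits g qs))
      (.ofBool (qs.any fun q => f q && g q)) (30 * (qs.length + 1)) := by
  induction qs with
  | nil => exact Within.conv (a := meetsBody) (.iteNil (.fst .var) rfl .nil) rfl (by simp)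
  | cons q qs ih =>
    -- The same recursive call occurs in two branches.
    have hr := Within.call (.cons (.snd (.fst (.var (P := prog m wt) (i := 0)
      (env := [.cons (bits f (q :: qs)) (bits g (q :: qs))]))))
      (.snd (.snd (.var (i := 0))))) ih
    exact Within.conv (a := meetsBody)
      (.iteCons (.fst .var) rfl (.iteBool (.fst (.fst .var)) rfl
        (fun _ => .iteBool (.fst (.snd .var)) rfl (fun _ => .one) (fun _ => hr)) (fun _ => hr)))
      (by cases h : f q <;> cases h' : g q <;> simp [h, h'])
      (by simp only [List.length_cons]; omega)

theorem calls_mem (x : Data) (l : List Data) :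
    Calls (prog m wt) fMem (.cons x (.ofList l)) (.ofBool (decide (x ∈ l)))
      ((30 * x.size + 30) * (l.length + 1)) := by
  induction l with
  | nil =>
    exact Within.conv (a := memBody) (.iteNil (.snd .var) rfl .nil) (by simp [Data.ofBool])
      (by simp)
  | cons y l ih =>
    exact Within.conv (a := memBody)
      (.iteCons (.snd .var) rfl (.iteBool
        (.call (.cons (.fst .var) (.fst (.snd .var))) (calls_eq x y)) rfl (fun _ => .one)
        (fun _ => .call (.cons (.fst .var) (.snd (.snd .var))) ih)))
      (by by_cases h : x = y <;> simp [h])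
      (by simp only [List.length_cons, Nat.mul_succ _ (l.length + 1)]; omega)

theorem Data.ofNat_succ (n : ℕ) : Data.ofNat (n + 1) = .cons .nil (.ofNat n) := rfl

theorem calls_le (a b : ℕ) :
    Calls (prog m wt) fLe (.cons (.ofNat a) (.ofNat b)) (.ofBool (decide (a ≤ b)))
      (20 * (a + 1)) := by
  induction a generalizing b with
  | zero =>
    exact Within.conv (a := leBody) (.iteNil (.fst .var) rfl .one) (by simp) (by simp)
  | succ a ih =>
    cases b with
    | zero =>
      exact Within.conv (a := leBody) (.iteCons (.fst .var) rfl (.iteNil (.snd .var) rfl .nil))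
        (by simp [Data.ofBool]) (by omega)
    | succ b =>
      exact Within.conv (a := leBody)
        (.iteCons (.fst .var) rfl (.iteCons (.snd .var) rfl
          (.call (.cons (.snd (.fst .var)) (.snd (.snd .var))) (ih b))))
        (by simp) (by omega)

theorem calls_replicate (n : ℕ) (x : Data) :
    Calls (prog m wt) fReplicate (.cons (.ofNat n) x) (.ofList (List.replicate n x))
      (20 * (n + 1)) := by
  induction n with
  | zero => exact Within.conv (a := replicateBody) (.iteNil (.fst .var) rfl .nil) rfl (by simp)
  | succ n ih =>
    exact Within.conv (a := replicateBody)
      (.iteCons (.fst .var) rfl (.cons (.snd .var)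
        (.call (.cons (.snd (.fst .var)) (.snd .var)) ih)))
      rfl (by omega)

theorem calls_count {ι : Type*} (f : ι → Bool) (qs : List ι) (n : ℕ) :
    Calls (prog m wt) fCount (.cons (bits f qs) (.ofNat n)) (.ofNat (qs.countP f + n))
      (20 * (qs.length + 1)) := by
  induction qs with
  | nil =>
    exact Within.conv (a := countBody) (.iteNil (.fst .var) rfl (.snd .var)) (by simp [Data.snd])
      (by simp)
  | cons q qs ih =>
    have hr := Within.call (.cons (.snd (.fst (.var (P := prog m wt) (i := 0)
      (env := [.cons (bits f (q :: qs)) (.ofNat n)])))) (.snd (.var (i := 0)))) ih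
    exact Within.conv (a := countBody)
      (.iteCons (.fst .var) rfl (.iteBool (.fst (.fst .var)) rfl (fun _ => .cons .nil hr)
        (fun _ => hr)))
      (by cases h : f q <;> simp [h, ← Data.ofNat_succ, Nat.add_right_comm])
      (by simp only [List.length_cons]; omega)

theorem calls_countRows {ι κ : Type*} (F : κ → ι → Bool) (qs : List ι) (as : List κ) (n : ℕ) :
    Calls (prog m wt) fCountRows (.cons (.ofList (as.map fun a => bits (F a) qs)) (.ofNat n))
      (.ofNat ((as.map fun a => qs.countP (F a)).sum + n))
      ((20 * (qs.length + 1) + 20) * (as.length + 1)) := by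
  induction as with
  | nil =>
    exact Within.conv (a := countRowsBody) (.iteNil (.fst .var) rfl (.snd .var))
      (by simp [Data.snd]) (by simp)
  | cons a as ih =>
    exact Within.conv (a := countRowsBody)
      (.iteCons (.fst .var) rfl (.call (.cons (.fst (.fst .var))
        (.call (.cons (.snd (.fst .var)) (.snd .var)) ih)) (calls_count (F a) qs _)))
      (by simp [Nat.add_assoc])
      (by simp only [List.length_cons, Nat.mul_succ _ (as.length + 1)]; omega)

theorem calls_countTable {ι κ ν : Type*} (F : ν → κ → ι → Bool) (qs : List ι) (as : List κ)
    (ps : List ν) (n : ℕ) :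
    Calls (prog m wt) fCountTable
      (.cons (.ofList (ps.map fun p => .ofList (as.map fun a => bits (F p a) qs))) (.ofNat n))
      (.ofNat ((ps.map fun p => (as.map fun a => qs.countP (F p a)).sum).sum + n))
      (((20 * (qs.length + 1) + 20) * (as.length + 1) + 20) * (ps.length + 1)) := by
  induction ps with
  | nil =>
    exact Within.conv (a := countTableBody) (.iteNil (.fst .var) rfl (.snd .var))
      (by simp [Data.snd]) (by simp)
  | cons p ps ih =>
    exact Within.conv (a := countTableBody)
      (.iteCons (.fst .var) rfl (.call (.cons (.fst (.fst .var))
        (.call (.cons (.snd (.fst .var)) (.snd .var)) ih)) (calls_countRows (F p) qs as _)))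
      (by simp [Nat.add_assoc])
      (by simp only [List.length_cons, Nat.mul_succ _ (ps.length + 1)]; omega)

theorem calls_max (a b : ℕ) :
    Calls (prog m wt) fMax (.cons (.ofNat a) (.ofNat b)) (.ofNat (max a b)) (20 * (a + 2)) := by
  exact Within.conv (a := maxBody)
    (.iteBool (.call .var (calls_le a b)) rfl (fun _ => .snd .var) (fun _ => .fst .var))
    (by
      rcases le_total a b with h | h
      · simp [h, Data.snd]
      · by_cases h' : a ≤ b
        · simp [h', Data.snd]
        · simp [h, h', Data.fst]) (by omega)

theorem calls_extend (l : List (List Bool)) :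
    Calls (prog m wt) fExtend (.ofList (l.map fun b => bits id b))
      (.ofList ((l.flatMap fun b => [false :: b, true :: b]).map fun b => bits id b))
      (30 * (l.length + 1)) := by
  induction l with
  | nil => exact Within.conv (a := extendBody) (.iteNil .var rfl .nil) rfl (by simp)
  | cons b l ih =>
    exact Within.conv (a := extendBody)
      (.iteCons .var rfl (.cons (.cons .nil (.fst .var)) (.cons (.cons .one (.fst .var))
        (.call (.snd .var) ih))))
      rfl (by simp only [List.length_cons]; omega)

/-- All lists of bits of a given length. -/
def bitLists : ℕ → List (List Bool)
  | 0 => [[]]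
  | n + 1 => (bitLists n).flatMap fun b => [false :: b, true :: b]

theorem length_bitLists (n : ℕ) : (bitLists n).length = 2 ^ n := by
  induction n with
  | zero => rfl
  | succ n ih => simp [bitLists, List.length_flatMap, ih, pow_succ]

theorem calls_subsets (n : ℕ) :
    Calls (prog m wt) fSubsets (.ofNat n) (.ofList ((bitLists n).map fun b => bits id b))
      ((30 * (2 ^ n + 1) + 20) * (n + 1)) := by
  induction n with
  | zero =>
    exact Within.conv (a := subsetsBody) (.iteNil .var rfl (.cons .nil .nil)) rfl (by simp)
  | succ n ih =>
    exact Within.conv (a := subsetsBody)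
      (.iteCons .var rfl (.call (.call (.snd .var) ih) (calls_extend _))) rfl
      (by
        -- The coefficient depends on `n` too, so it is enlarged before the last factor is split
        -- off.
        have : (30 * (2 ^ n + 1) + 20) * (n + 1) ≤ (30 * (2 ^ (n + 1) + 1) + 20) * (n + 1) :=
          Nat.mul_le_mul_right _ (by have := Nat.pow_succ 2 n; omega)
        have := Nat.pow_succ 2 n
        rw [length_bitLists, Nat.mul_succ _ (n + 1)]
        omega)

theorem calls_pairWith {ι : Type*} (f : ι → Data) (a : Data) (l : List ι) (acc : List Data) :
    Calls (prog m wt) fPairWith (.cons a (.cons (.ofList (l.map f)) (.ofList acc)))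
      (.ofList (l.map (fun b => .cons a (f b)) ++ acc)) (30 * (l.length + 1)) := by
  induction l with
  | nil =>
    exact Within.conv (a := pairWithBody) (.iteNil (.fst (.snd .var)) rfl (.snd (.snd .var))) rfl
      (by simp)
  | cons b l ih =>
    exact Within.conv (a := pairWithBody)
      (.iteCons (.fst (.snd .var)) rfl (.cons (.cons (.fst .var) (.fst (.fst (.snd .var))))
        (.call (.cons (.fst .var) (.cons (.snd (.fst (.snd .var))) (.snd (.snd .var)))) ih)))
      rfl (by simp only [List.length_cons]; omega)

theorem calls_pairs {ι κ : Type*} (f : ι → Data) (g : κ → Data) (l : List ι) (l' : List κ) :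
    Calls (prog m wt) fPairs (.cons (.ofList (l.map f)) (.ofList (l'.map g)))
      (.ofList ((l.product l').map fun q => .cons (f q.1) (g q.2)))
      ((30 * (l'.length + 1) + 30) * (l.length + 1)) := by
  induction l with
  | nil =>
    exact Within.conv (a := pairsBody) (.iteNil (.fst .var) rfl .nil) rfl (by simp)
  | cons a l ih =>
    exact Within.conv (a := pairsBody)
      (.iteCons (.fst .var) rfl (.call (.cons (.fst (.fst .var)) (.cons (.snd .var)
        (.call (.cons (.snd (.fst .var)) (.snd .var)) ih))) (calls_pairWith g (f a) l' _)))
      (by simp [List.product, Function.comp_def, List.map_flatMap])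
      (by simp only [List.length_cons, Nat.mul_succ _ (l.length + 1)]; omega)

end ODD

namespace ODD
open scoped Classical

/-! ### Keeping the lightest element for each key -/

section Lightest

variable {β : Type*}

/-- Inserts `c` into a list that holds at most one element for each key, keeping the lighter of
two elements with the same key. -/
noncomputable def insertLightest (κ : β → Data) (μ : β → ℕ) (c : β) : List β → List β
  | [] => [c]
  | d :: ds =>
    if κ c = κ d then (if μ c ≤ μ d then c :: ds else d :: ds)
    else d :: insertLightest κ μ c ds

/-- The first lightest among the elements of a list with a property. -/
noncomputable def lightest (ok : β → Prop) (μ : β → ℕ) : List β → Option β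
  | [] => none
  | c :: cs =>
    if ok c then
      match lightest ok μ cs with
      | none => some c
      | some d => if μ c ≤ μ d then some c else some d
    else lightest ok μ cs

variable {κ : β → Data} {μ : β → ℕ} {ok : β → Prop} {c : β}

theorem mem_of_mem_insertLightest {x : β} {ds : List β} (h : x ∈ insertLightest κ μ c ds) :
    x = c ∨ x ∈ ds := by
  induction ds with
  | nil => simpa [insertLightest] using h
  | cons d ds ih =>
    simp only [insertLightest] at h
    split_ifs at h <;> simp only [List.mem_cons] at h ⊢ <;> tauto

/-- A replacement happens only between elements with equal keys, so the list of keys either stays as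
it is or grows by a new key at its end. -/
theorem map_insertLightest (ds : List β) :
    (insertLightest κ μ c ds).map κ =
      if κ c ∈ ds.map κ then ds.map κ else ds.map κ ++ [κ c] := by
  induction ds with
  | nil => simp [insertLightest]
  | cons d ds ih =>
    by_cases h : κ c = κ d
    · by_cases h' : μ c ≤ μ d <;> simp [insertLightest, h, h']
    · simp only [insertLightest, h, if_false, List.map_cons, ih, List.mem_cons, false_or]
      split_ifs <;> simp

theorem nodup_insertLightest {ds : List β} (h : (ds.map κ).Nodup) :
    ((insertLightest κ μ c ds).map κ).Nodup := by
  rw [map_insertLightest]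
  split_ifs with hc
  · exact h
  · exact List.nodup_append.2 ⟨h, by simp, by
      rintro x hx y hy rfl
      exact hc (List.mem_singleton.1 hy ▸ hx)⟩

/-- Nothing of value is lost: whatever is dropped leaves behind an element with the same key that is
no heavier. -/
theorem exists_le_insertLightest {x : β} {ds : List β} (hx : x = c ∨ x ∈ ds) :
    ∃ y ∈ insertLightest κ μ c ds, κ y = κ x ∧ μ y ≤ μ x := by
  induction ds with
  | nil => exact ⟨c, by simp [insertLightest], by simp_all⟩
  | cons d ds ih =>
    simp only [insertLightest]
    split_ifs with h h'
    · rcases hx with rfl | hx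
      · exact ⟨x, by simp⟩
      · rcases List.mem_cons.1 hx with rfl | hx
        · exact ⟨c, by simp, h, h'⟩
        · exact ⟨x, by simp [hx]⟩
    · rcases hx with rfl | hx
      · exact ⟨d, by simp, h.symm, by omega⟩
      · exact ⟨x, hx, by simp⟩
    · rcases hx with rfl | hx
      · obtain ⟨y, hy, h⟩ := ih (.inl rfl)
        exact ⟨y, by simp [hy], h⟩
      · rcases List.mem_cons.1 hx with rfl | hx
        · exact ⟨x, by simp⟩
        · obtain ⟨y, hy, h⟩ := ih (.inr hx)
          exact ⟨y, by simp [hy], h⟩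

theorem lightest_eq_none {cs : List β} (h : lightest ok μ cs = none) : ∀ c ∈ cs, ¬ ok c := by
  induction cs with
  | nil => simp
  | cons c cs ih =>
    simp only [lightest] at h
    split_ifs at h with hc
    · split at h
      · simp at h
      · split_ifs at h
    · simpa [hc] using ih h

theorem lightest_eq_some {d : β} {cs : List β} (h : lightest ok μ cs = some d) :
    d ∈ cs ∧ ok d ∧ ∀ c ∈ cs, ok c → μ d ≤ μ c := by
  induction cs generalizing d with
  | nil => simp [lightest] at h
  | cons c cs ih =>
    simp only [lightest] at h
    split_ifs at h with hc
    · split at h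
      · rename_i hn
        obtain rfl := Option.some.inj h
        refine ⟨by simp, hc, fun e he hoe => ?_⟩
        rcases List.mem_cons.1 he with rfl | he
        · rfl
        · exact absurd hoe (lightest_eq_none hn e he)
      · rename_i e he
        obtain ⟨h₁, h₂, h₃⟩ := ih he
        split_ifs at h with hle
        · obtain rfl := Option.some.inj h
          refine ⟨by simp, hc, fun x hx hox => ?_⟩
          rcases List.mem_cons.1 hx with rfl | hx
          · rfl
          · exact hle.trans (h₃ x hx hox)
        · obtain rfl := Option.some.inj h
          refine ⟨by simp [h₁], h₂, fun x hx hox => ?_⟩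
          rcases List.mem_cons.1 hx with rfl | hx
          · omega
          · exact h₃ x hx hox
    · obtain ⟨h₁, h₂, h₃⟩ := ih h
      refine ⟨by simp [h₁], h₂, fun x hx hox => ?_⟩
      rcases List.mem_cons.1 hx with rfl | hx
      · exact absurd hox hc
      · exact h₃ x hx hox

end Lightest

/-! ### Right languages -/

section Language

variable {α : Type*} {w : ℕ}

/-- The states reached from the set `A` by transitions with the letter `a`. -/
noncomputable def post (T : Finset (Fin w × α × Fin w)) (A : Finset (Fin w)) (a : α) :
    Finset (Fin w) :=
  Finset.univ.filter fun q => ∃ p ∈ A, (p, a, q) ∈ T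

/-- Some state of the set `A` accepts the string in the string of layers. -/
def Accepts : List (Layer α w) → Finset (Fin w) → List α → Prop
  | [], _, _ => False
  | _ :: _, _, [] => False
  | L :: D, A, a :: s =>
    (D = [] ∧ s = [] ∧ (post L.trans A a ∩ L.fin).Nonempty) ∨ Accepts D (post L.trans A a) s

/-- The right language of a set of states. -/
def rlang (D : List (Layer α w)) (A : Finset (Fin w)) : Set (List α) := {s | Accepts D A s}

/-- The initial states of a string of layers. -/
def firstInit : List (Layer α w) → Finset (Fin w)
  | [] => ∅
  | L :: _ => L.init

/-- The subset construction: the first transition of a run is absorbed into the set of states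
reached by it. The start set is generalized in the induction because it changes with each letter. -/
theorem accepts_iff (D : List (Layer α w)) (A : Finset (Fin w)) (s : List α) :
    Accepts D A s ↔ ∃ r, List.Forall₂ (fun e L => e ∈ L.trans) r D ∧ r.map (fun e => e.2.1) = s ∧
      r.IsChain (fun e e' => e'.1 = e.2.2) ∧ (∃ e ∈ r.head?, e.1 ∈ A) ∧
      ∃ e ∈ r.getLast?, ∃ L ∈ D.getLast?, e.2.2 ∈ L.fin := by
  induction D generalizing A s with
  | nil => simp [Accepts]
  | cons L D ih =>
    cases s with
    | nil =>
      simp only [Accepts, false_iff]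
      rintro ⟨r, h₁, h₂, -⟩
      simp only [List.map_eq_nil_iff] at h₂
      subst h₂
      cases h₁
    | cons a s =>
      simp only [Accepts]
      constructor
      · rintro (⟨rfl, rfl, q, hq⟩ | h)
        · simp only [Finset.mem_inter, post, Finset.mem_filter, Finset.mem_univ, true_and] at hq
          obtain ⟨⟨p, hp, ht⟩, hq⟩ := hq
          exact ⟨[(p, a, q)], by simp [ht, hp, hq]⟩
        · obtain ⟨r, h₁, h₂, h₃, ⟨e, he, heA⟩, h₅⟩ := (ih _ _).1 h
          simp only [post, Finset.mem_filter, Finset.mem_univ, true_and] at heA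
          obtain ⟨p, hp, ht⟩ := heA
          obtain ⟨r, rfl⟩ : ∃ r', r = e :: r' := by
            cases r with
            | nil => simp at he
            | cons x r => simp at he; exact ⟨r, by rw [he]⟩
          cases h₁ with
          | @cons _ M _ D' hM hD =>
          refine ⟨(p, a, e.1) :: e :: r, .cons ht (.cons hM hD), by simp [← h₂], ?_, ?_, ?_⟩
          · simp [h₃]
          · simp [hp]
          · simpa [List.getLast?_cons_cons] using h₅
      · rintro ⟨r, h₁, h₂, h₃, ⟨e, he, heA⟩, h₅⟩
        cases h₁ with
        | @cons x _ r _ hx hr =>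
        simp only [List.head?_cons, Option.mem_some_iff] at he
        subst he
        simp only [List.map_cons, List.cons.injEq] at h₂
        obtain ⟨rfl, rfl⟩ := h₂
        cases hr with
        | nil =>
          left
          refine ⟨rfl, rfl, x.2.2, ?_⟩
          simp only [List.getLast?_singleton, Option.mem_some_iff, exists_eq_left'] at h₅
          simp only [Finset.mem_inter, post, Finset.mem_filter, Finset.mem_univ, true_and]
          exact ⟨⟨x.1, heA, hx⟩, h₅⟩
        | @cons y M r D hy hr =>
          right
          rw [List.isChain_cons_cons] at h₃
          refine (ih _ _).2 ⟨y :: r, .cons hy hr, rfl, h₃.2, ⟨y, by simp, ?_⟩, ?_⟩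
          · simp only [post, Finset.mem_filter, Finset.mem_univ, true_and]
            exact ⟨x.1, heA, h₃.1 ▸ hx⟩
          · simpa [List.getLast?_cons_cons] using h₅

/-- Splits equality of languages into equality of lengths and equality of right languages of the
initial states. -/
theorem lang_eq (D : List (Layer α w)) : lang D = (D.length, rlang D (firstInit D)) := by
  refine Prod.ext rfl (Set.ext fun s => ?_)
  simp only [lang, rlang, Set.mem_ofPred_eq]
  rw [accepts_iff]
  refine exists_congr fun r => ⟨fun h => ⟨h.trans, h.letters, h.linked, ?_, h.final⟩,
    fun ⟨h₁, h₂, h₃, h₄, h₅⟩ => ⟨h₁, h₂, h₃, ?_, h₅⟩⟩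
  · obtain ⟨e, he, L, hL, hi⟩ := h.initial
    cases D with
    | nil => simp at hL
    | cons M D =>
      simp only [List.head?_cons, Option.mem_some_iff] at hL
      exact ⟨e, he, by simpa [firstInit, hL] using hi⟩
  · obtain ⟨e, he, h⟩ := h₄
    cases D with
    | nil => simp [firstInit] at h
    | cons M D => exact ⟨e, he, M, by simp, h⟩

/-- Both sides reject the empty string, and any other string is a letter with a rest. If nothing
follows, the rest has to be empty and only the final states count; otherwise the final states of
this layer are irrelevant. -/
theorem rlang_cons_eq_iff {D D' : List (Layer α w)} (hD : D = [] ↔ D' = []) (L L' : Layer α w)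
    (A B : Finset (Fin w)) :
    rlang (L :: D) A = rlang (L' :: D') B ↔ ∀ a,
      if D = [] then
        ((post L.trans A a ∩ L.fin).Nonempty ↔ (post L'.trans B a ∩ L'.fin).Nonempty)
      else rlang D (post L.trans A a) = rlang D' (post L'.trans B a) := by
  by_cases h : D = []
  · obtain rfl := hD.1 h
    subst h
    simp only [rlang, Set.ext_iff, Set.mem_ofPred_eq, if_true]
    constructor
    · intro h a
      simpa [Accepts] using h [a]
    · rintro h (_ | ⟨a, s⟩)
      · simp [Accepts]
      · simp [Accepts, h a]
  · have h' : D' ≠ [] := fun e => h (hD.2 e)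
    simp only [rlang, Set.ext_iff, Set.mem_ofPred_eq, h, if_false]
    constructor
    · intro hs a s
      simpa [Accepts, h, h'] using hs (a :: s)
    · rintro hs (_ | ⟨a, s⟩)
      · simp [Accepts]
      · simp [Accepts, h, h', hs a]

end Language

/-! ### Strings of layers that fit to a diagram -/

section Fitting

variable {α : Type*} {w : ℕ}

/-- The layer `L'` can stand in front of `c` in place of `L`. -/
def Fits (L : Layer α w) (c : List (Layer α w)) (L' : Layer α w) : Prop :=
  L'.initFlag = L.initFlag ∧ L'.finFlag = L.finFlag ∧
    (L.finFlag = true ∨ ∃ M ∈ c.head?, M.left = L'.right)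

/-- The string `c` of layers from `l` can replace `D`. -/
def Valid (l : List (Layer α w)) : List (Layer α w) → List (Layer α w) → Prop
  | [], [] => True
  | L :: D, L' :: c => L' ∈ l ∧ Fits L c L' ∧ Valid l D c
  | [], _ :: _ => False
  | _ :: _, [] => False

/-- Exactly the last layer has its final flag set. -/
def FinalLast (D : List (Layer α w)) : Prop :=
  ∀ (i : ℕ) (h : i < D.length), D[i].finFlag = true ↔ i + 1 = D.length

/-- Proper suffixes of a diagram are not diagrams, as their initial flags are not set; this is the
part of the definition that survives in the induction. -/
theorem FinalLast.tail {L : Layer α w} {D : List (Layer α w)} (h : FinalLast (L :: D)) :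
    FinalLast D := fun i hi => by
  have := h (i + 1) (by simpa using hi)
  rw [List.getElem_cons_succ] at this
  rw [this]
  simp

theorem FinalLast.head {L : Layer α w} {D : List (Layer α w)} (h : FinalLast (L :: D)) :
    L.finFlag = true ↔ D = [] := by
  have := h 0 (by simp)
  rw [List.getElem_cons_zero] at this
  rw [this, List.length_cons, ← List.length_eq_zero_iff]
  omega

variable {l D c : List (Layer α w)}

theorem Valid.length_eq (h : Valid l D c) : c.length = D.length := by
  induction D generalizing c with
  | nil => cases c <;> simp_all [Valid]
  | cons L D ih =>
    cases c with
    | nil => simp [Valid] at h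
    | cons L' c => simpa using ih h.2.2

theorem Valid.eq_nil_iff (h : Valid l D c) : D = [] ↔ c = [] := by
  rw [← List.length_eq_zero_iff, ← h.length_eq, List.length_eq_zero_iff]

/-- `Fits` waives the frontier condition where the final flag is set. This is harmless, because that
happens exactly at the last layer, which has no successor. -/
theorem valid_iff (hD : FinalLast D) : Valid l D c ↔
    (∀ L ∈ c, L ∈ l) ∧ c.IsChain (fun L L' => L'.left = L.right) ∧
      List.Forall₂ (fun L' L => L'.initFlag = L.initFlag ∧ L'.finFlag = L.finFlag) c D := by
  induction D generalizing c with
  | nil => cases c <;> simp [Valid]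
  | cons L D ih =>
    cases c with
    | nil => simp [Valid]
    | cons L' c =>
      simp only [Valid, Fits, ih hD.tail, hD.head, List.mem_cons, forall_eq_or_imp,
        List.forall₂_cons]
      cases c with
      | nil => cases D <;> simp
      | cons M c =>
        cases D with
        | nil => simp
        | cons N D => simp [List.isChain_cons_cons]; tauto

/-- The flags of a diagram are determined by the positions, so agreeing with the flags of `D`
everywhere is the same as having the flags of a diagram of the same length. -/
theorem valid_iff_mem_oddsOfLength {S : Set (Layer α w)} {k : ℕ} (hl : ∀ L, L ∈ l ↔ L ∈ S)
    (hD : D ∈ oddsOfLength Set.univ k) : Valid l D c ↔ c ∈ oddsOfLength S k := by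
  obtain ⟨hO, hk, -⟩ := hD
  rw [valid_iff (fun i h => hO.finFlag i h), List.forall₂_iff_get]
  constructor
  · rintro ⟨h₁, h₂, h₃, h₄⟩
    refine ⟨⟨?_, h₂, fun i hi => ?_, fun i hi => ?_⟩, h₃.trans hk, fun L hL => (hl L).1 (h₁ L hL)⟩
    · rintro rfl
      exact hO.ne_nil (List.length_eq_zero_iff.1 h₃.symm)
    · have := (h₄ i hi (h₃ ▸ hi)).1
      simp only [List.get_eq_getElem] at this
      rw [this, hO.initFlag]
    · have := (h₄ i hi (h₃ ▸ hi)).2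
      simp only [List.get_eq_getElem] at this
      rw [this, hO.finFlag, h₃]
  · rintro ⟨hc, hk', hS⟩
    refine ⟨fun L hL => (hl L).2 (hS L hL), hc.frontier, hk'.trans hk.symm, fun i hi hi' => ?_⟩
    simp only [List.get_eq_getElem]
    refine ⟨Bool.eq_iff_iff.2 ((hc.initFlag i hi).trans (hO.initFlag i hi').symm),
      Bool.eq_iff_iff.2 ?_⟩
    rw [hc.finFlag, hO.finFlag, hk, hk']

end Fitting

end ODD

namespace ODD
open scoped Classical

/-! ### Lists of sets of states, and keys -/

section Keys

variable {α : Type*} {w : ℕ}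

theorem Data.ofList_injective : Function.Injective Data.ofList := by
  intro l l' h
  induction l generalizing l' with
  | nil => cases l' <;> simp_all [Data.ofList]
  | cons a l ih =>
    cases l' with
    | nil => simp [Data.ofList] at h
    | cons b l' =>
      simp only [Data.ofList, Data.cons.injEq] at h
      rw [h.1, ih h.2]

theorem encodeStates_injective : Function.Injective (encodeStates (w := w)) := by
  intro A B h
  have h := Data.ofList_injective h
  ext p
  have := List.map_inj_left.1 h p (List.mem_finRange p)
  simpa [Data.ofBool_inj] using this

/-- The set of states given by its list of membership bits. -/
def ofBits (w : ℕ) (b : List Bool) : Finset (Fin w) :=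
  Finset.univ.filter fun p => b.getD p false = true

theorem length_of_mem_bitLists {n : ℕ} {b : List Bool} (h : b ∈ bitLists n) : b.length = n := by
  induction n generalizing b with
  | zero => simpa [bitLists] using h
  | succ n ih =>
    simp only [bitLists, List.mem_flatMap] at h
    obtain ⟨b', hb', h⟩ := h
    simp only [List.mem_cons, List.not_mem_nil, or_false] at h
    rcases h with rfl | rfl <;> simp [ih hb']

theorem mem_bitLists (b : List Bool) : b ∈ bitLists b.length := by
  induction b with
  | nil => simp [bitLists]
  | cons x b ih =>
    simp only [List.length_cons, bitLists, List.mem_flatMap]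
    exact ⟨b, ih, by cases x <;> simp⟩

theorem encodeStates_ofBits {b : List Bool} (h : b.length = w) :
    encodeStates (ofBits w b) = bits id b := by
  unfold encodeStates bits
  congr 1
  apply List.ext_getElem
  · simp [h]
  · intro i h₁ h₂
    simp only [List.length_map] at h₁ h₂
    simp [ofBits, h₂]

theorem ofBits_surjective (A : Finset (Fin w)) : ∃ b ∈ bitLists w, ofBits w b = A := by
  refine ⟨(List.finRange w).map fun p => decide (p ∈ A), ?_, ?_⟩
  · simpa using mem_bitLists ((List.finRange w).map fun p => decide (p ∈ A))
  · ext p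
    simp [ofBits]

/-- All sets of states. -/
def subsets (w : ℕ) : List (Finset (Fin w)) := (bitLists w).map (ofBits w)

/-- All pairs of sets of states. -/
def statePairs (w : ℕ) : List (Finset (Fin w) × Finset (Fin w)) :=
  (subsets w).product (subsets w)

theorem mem_statePairs (q : Finset (Fin w) × Finset (Fin w)) : q ∈ statePairs w := by
  obtain ⟨b, hb, h⟩ := ofBits_surjective q.1
  obtain ⟨b', hb', h'⟩ := ofBits_surjective q.2
  exact List.mem_product.2 ⟨List.mem_map.2 ⟨b, hb, h⟩, List.mem_map.2 ⟨b', hb', h'⟩⟩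

theorem length_statePairs (w : ℕ) : (statePairs w).length = 2 ^ w * 2 ^ w :=
  (List.length_product _ _).trans (by simp [subsets, length_bitLists])

theorem map_encodeStates_subsets (w : ℕ) :
    (subsets w).map encodeStates = (bitLists w).map fun b => bits id b := by
  rw [subsets, List.map_map]
  exact List.map_congr_left fun b hb => encodeStates_ofBits (length_of_mem_bitLists hb)

/-- A pair of sets of states as data. -/
def encodePair (q : Finset (Fin w) × Finset (Fin w)) : Data :=
  .cons (encodeStates q.1) (encodeStates q.2)

theorem encodePair_injective : Function.Injective (encodePair (w := w)) := by
  rintro ⟨A, B⟩ ⟨A', B'⟩ h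
  simp only [encodePair, Data.cons.injEq] at h
  rw [encodeStates_injective h.1, encodeStates_injective h.2]

/-- The pairs of sets of states with the same right language. -/
noncomputable def equivalentPairs (D c : List (Layer α w)) : List Data :=
  ((statePairs w).filter fun q => decide (rlang D q.1 = rlang c q.2)).map encodePair

theorem mem_equivalentPairs {D c : List (Layer α w)} {A B : Finset (Fin w)} :
    encodePair (A, B) ∈ equivalentPairs D c ↔ rlang D A = rlang c B := by
  simp only [equivalentPairs, List.mem_map_of_injective encodePair_injective, List.mem_filter,
    mem_statePairs, true_and, decide_eq_true_eq]

/-- What matters of the string of layers `c`, replacing `D`, for the layers in front of it. -/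
noncomputable def key (D : List (Layer α w)) : List (Layer α w) → Data
  | [] => .nil
  | L :: c => .cons (encodeStates L.left)
    (.cons (encodeStates L.init) (.ofList (equivalentPairs D (L :: c))))

/-- The pairs in a key determine the relation, since the encoding of pairs is injective. For the
empty string the key holds no pairs, hence the two assumptions. -/
theorem rlang_iff_of_key_eq {D c c' : List (Layer α w)} (hc : c ≠ []) (hc' : c' ≠ [])
    (h : key D c = key D c') (A B : Finset (Fin w)) :
    rlang D A = rlang c B ↔ rlang D A = rlang c' B := by
  obtain ⟨L, c, rfl⟩ := List.exists_cons_of_ne_nil hc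
  obtain ⟨L', c', rfl⟩ := List.exists_cons_of_ne_nil hc'
  simp only [key, Data.cons.injEq] at h
  rw [← mem_equivalentPairs, ← mem_equivalentPairs, Data.ofList_injective h.2.2]

variable {l D c c' : List (Layer α w)} {L L' : Layer α w}

/-- The pairs of equivalent sets that are part of the key. -/
noncomputable def keyPairs (D c : List (Layer α w)) : List Data :=
  if c = [] then [] else equivalentPairs D c

theorem length_keyPairs_le (D c : List (Layer α w)) :
    (keyPairs D c).length ≤ 2 ^ w * 2 ^ w := by
  unfold keyPairs
  split_ifs
  · simp
  · rw [equivalentPairs, List.length_map, ← length_statePairs]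
    exact List.length_filter_le _ _

/-- The components of `.nil` are `.nil`, so reading off the pairs needs no test for the empty
string. -/
theorem snd_snd_key (D c : List (Layer α w)) : (key D c).snd.snd = .ofList (keyPairs D c) := by
  cases c with
  | nil => simp [keyPairs, key, Data.snd, Data.ofList]
  | cons L c => simp [keyPairs, key, Data.snd]

/-- The form in which the program tests fitting: behind a layer that is not the last one `c` is
nonempty, so its key does begin with a left frontier. -/
theorem fits_iff (hD : FinalLast (L :: D)) (hc : Valid l D c) :
    Fits L c L' ↔ L.initFlag = L'.initFlag ∧ L.finFlag = L'.finFlag ∧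
      (L.finFlag = true ∨ encodeStates L'.right = (key D c).fst) := by
  refine Iff.and eq_comm (Iff.and eq_comm (or_congr_right' fun h => ?_))
  obtain ⟨M, c, rfl⟩ := List.exists_cons_of_ne_nil
    (mt hc.eq_nil_iff.2 (mt hD.head.2 h))
  simp [key, Data.fst, encodeStates_injective.eq_iff, eq_comm]

/-- First half of the exchange argument: which layers fit in front depends on the key only. -/
theorem Fits.congr (hc : Valid l D c) (hc' : Valid l D c') (h : key D c = key D c')
    (hf : Fits L c L') : Fits L c' L' := by
  refine ⟨hf.1, hf.2.1, hf.2.2.imp id ?_⟩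
  rintro ⟨M, hM, hL⟩
  cases c with
  | nil => simp at hM
  | cons N c =>
    cases c' with
    | nil => simp [key] at h
    | cons N' c' =>
      simp only [key, Data.cons.injEq] at h
      simp only [List.head?_cons, Option.mem_some_iff] at hM
      subst hM
      exact ⟨N', by simp, by rw [← hL, encodeStates_injective h.1]⟩

/-- Second half of the exchange argument: the key after one more layer depends on the key before it.
The pairs are filtered from one fixed list, so equal relations even give equal lists. -/
theorem key_cons_congr (hc : Valid l D c) (hc' : Valid l D c') (h : key D c = key D c') :
    key (L :: D) (L' :: c) = key (L :: D) (L' :: c') := by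
  simp only [key, equivalentPairs, Data.cons.injEq, true_and]
  congr 3
  ext q
  rw [decide_eq_decide, rlang_cons_eq_iff hc.eq_nil_iff, rlang_cons_eq_iff hc'.eq_nil_iff]
  refine forall_congr' fun a => ?_
  split_ifs with hD
  · rfl
  · exact rlang_iff_of_key_eq (mt hc.eq_nil_iff.2 hD) (mt hc'.eq_nil_iff.2 hD) h _ _

/-- A bound on the number of keys. -/
def keyCount (w : ℕ) : ℕ := 2 ^ w * (2 ^ w * (2 ^ w + 1) ^ 2 ^ w)

/-- The source of the time bound. For fixed `D`, the sets related to a given B are either none or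
all those whose right language in `D` is that of B in `c`. One representative, or `none`, for each B
therefore determines the whole relation. -/
theorem length_le_keyCount {cs : List (List (Layer α w))} (hv : ∀ c ∈ cs, Valid l D c)
    (hn : (cs.map (key D)).Nodup) : cs.length ≤ keyCount w := by
  rw [← List.length_map (f := key D), ← List.toFinset_card_of_nodup hn]
  by_cases hD : D = []
  · have : (cs.map (key D)).toFinset ⊆ {Data.nil} := by
      intro x hx
      simp only [List.mem_toFinset, List.mem_map] at hx
      obtain ⟨c, hc, rfl⟩ := hx
      rw [(hv c hc).eq_nil_iff.1 hD]
      simp [key]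
    refine (Finset.card_le_card this).trans ?_
    rw [Finset.card_singleton]
    exact Nat.succ_le_of_lt (by unfold keyCount; positivity)
  -- Rebuilds a key from a left frontier, initial states, and a partial function that names a
  -- representative for each set.
  · let G : Finset (Fin w) × Finset (Fin w) × (Finset (Fin w) → Option (Finset (Fin w))) → Data :=
      fun x => .cons (encodeStates x.1) (.cons (encodeStates x.2.1)
        (.ofList (((statePairs w).filter fun q =>
          decide (∃ A ∈ x.2.2 q.2, rlang D q.1 = rlang D A)).map encodePair)))
    have : (cs.map (key D)).toFinset ⊆ Finset.univ.image G := by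
      intro x hx
      simp only [List.mem_toFinset, List.mem_map] at hx
      obtain ⟨c, hc, rfl⟩ := hx
      obtain ⟨L, c, rfl⟩ := List.exists_cons_of_ne_nil (mt (hv c hc).eq_nil_iff.2 hD)
      -- Any set related to `B` serves as its representative.
      refine Finset.mem_image.2 ⟨⟨L.left, L.init, fun B =>
        if h : ∃ A, rlang D A = rlang (L :: c) B then some h.choose else none⟩,
        Finset.mem_univ _, ?_⟩
      simp only [G, key, equivalentPairs, Data.cons.injEq, true_and]
      congr 3
      ext q
      rw [decide_eq_decide]
      by_cases h : ∃ A, rlang D A = rlang (L :: c) q.2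
      · simp only [h, dif_pos, Option.mem_some_iff, exists_eq_left', h.choose_spec]
      · simp only [h, dif_neg, not_false_eq_true, Option.not_mem_none, false_and, exists_false,
          false_iff]
        exact fun e => h ⟨_, e⟩
    refine (Finset.card_le_card this).trans (Finset.card_image_le.trans ?_)
    simp [keyCount, Fintype.card_option]

theorem size_encodeStates_le (A : Finset (Fin w)) : (encodeStates A).size ≤ 4 * w + 1 := by
  simpa [bits, encodeStates] using size_bits_le (fun p => decide (p ∈ A)) (List.finRange w)

theorem size_encodePair_le (q : Finset (Fin w) × Finset (Fin w)) :
    (encodePair q).size ≤ 8 * w + 3 := by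
  have h₁ := size_encodeStates_le q.1
  have h₂ := size_encodeStates_le q.2
  simp only [encodePair, Data.size]
  omega

/-- A bound on the size of keys. -/
def keySize (w : ℕ) : ℕ := (8 * w + 4) * (2 ^ w * 2 ^ w) + 8 * w + 5

theorem size_key_le (D c : List (Layer α w)) : (key D c).size ≤ keySize w := by
  cases c with
  | nil => simp only [key, Data.size, keySize]; omega
  | cons L c =>
    have h₁ := size_encodeStates_le L.left
    have h₂ := size_encodeStates_le L.init
    have h₃ : _ ≤ (8 * w + 4) * _ + 1 := size_ofList_map_le encodePair (8 * w + 3)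
      ((statePairs w).filter fun q => decide (rlang D q.1 = rlang (L :: c) q.2))
      fun q _ => size_encodePair_le q
    have h₄ := Nat.mul_le_mul_left (8 * w + 4) (((List.length_filter_le
      (fun q => decide (rlang D q.1 = rlang (L :: c) q.2)) (statePairs w))).trans_eq
        (length_statePairs w))
    simp only [key, Data.size, keySize, equivalentPairs]
    omega

end Keys

/-! ### Computing the lightest strings of layers for all keys -/

section Solve

variable {α : Type*} {w : ℕ}

/-- The weight of a string of layers. -/
def weight (stp : Layer α w → ℕ → ℕ) (c : List (Layer α w)) : ℕ := c.foldr stp 0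

/-- Extends `c` by the fitting layers from a list. -/
noncomputable def extendBy (stp : Layer α w → ℕ → ℕ) (D : List (Layer α w)) (L : Layer α w)
    (c : List (Layer α w)) (acc : List (List (Layer α w))) :
    List (Layer α w) → List (List (Layer α w))
  | [] => acc
  | L' :: l =>
    if Fits L c L' then
      insertLightest (key (L :: D)) (weight stp) (L' :: c) (extendBy stp D L c acc l)
    else extendBy stp D L c acc l

/-- Extends all strings from a list by the fitting layers. -/
noncomputable def extendAll (stp : Layer α w → ℕ → ℕ) (l D : List (Layer α w)) (L : Layer α w) :
    List (List (Layer α w)) → List (List (Layer α w))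
  | [] => []
  | c :: cs => extendBy stp D L c (extendAll stp l D L cs) l

/-- Lightest strings of layers from `l` that can replace `D`, for all keys. -/
noncomputable def solve (stp : Layer α w → ℕ → ℕ) (l : List (Layer α w)) :
    List (Layer α w) → List (List (Layer α w))
  | [] => [[]]
  | L :: D => extendAll stp l D L (solve stp l D)

/-- The strings in a list can replace `D` and have different keys. -/
def Sound (l D : List (Layer α w)) (cs : List (List (Layer α w))) : Prop :=
  (∀ c ∈ cs, Valid l D c) ∧ (cs.map (key D)).Nodup

variable {stp : Layer α w → ℕ → ℕ} {l D c : List (Layer α w)} {L : Layer α w}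
  {acc cs : List (List (Layer α w))}

theorem sound_extendBy {ls : List (Layer α w)} (hls : ∀ M ∈ ls, M ∈ l) (hc : Valid l D c)
    (h : Sound l (L :: D) acc) : Sound l (L :: D) (extendBy stp D L c acc ls) := by
  induction ls with
  | nil => exact h
  | cons L' ls ih =>
    have ih := ih fun M hM => hls M (by simp [hM])
    simp only [extendBy]
    split_ifs with hf
    · refine ⟨fun x hx => ?_, nodup_insertLightest ih.2⟩
      rcases mem_of_mem_insertLightest hx with rfl | hx
      · exact ⟨hls L' (by simp), hf, hc⟩
      · exact ih.1 x hx
    · exact ih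

/-- Every candidate, old or new, stays dominated by an element with its key through all later
insertions. -/
theorem exists_le_extendBy {ls : List (Layer α w)} {x : List (Layer α w)}
    (hx : x ∈ acc ∨ ∃ L' ∈ ls, Fits L c L' ∧ x = L' :: c) :
    ∃ y ∈ extendBy stp D L c acc ls, key (L :: D) y = key (L :: D) x ∧
      weight stp y ≤ weight stp x := by
  induction ls with
  | nil =>
    simp only [List.not_mem_nil, false_and, exists_false, or_false] at hx
    exact ⟨x, hx, rfl, le_rfl⟩
  | cons L' ls ih =>
    simp only [extendBy]
    -- Either the candidate was dominated before the present insertion, or it is the string being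
    -- inserted.
    by_cases hq : x ∈ acc ∨ ∃ L' ∈ ls, Fits L c L' ∧ x = L' :: c
    · obtain ⟨y, hy, h₁, h₂⟩ := ih hq
      split_ifs with hf
      · obtain ⟨z, hz, h₃, h₄⟩ := exists_le_insertLightest (κ := key (L :: D))
          (μ := weight stp) (c := L' :: c) (.inr hy)
        exact ⟨z, hz, h₃.trans h₁, h₄.trans h₂⟩
      · exact ⟨y, hy, h₁, h₂⟩
    · obtain ⟨hf, rfl⟩ : Fits L c L' ∧ x = L' :: c := by
        push Not at hq
        rcases hx with hx | ⟨M, hM, hf, hx⟩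
        · exact absurd hx hq.1
        · rcases List.mem_cons.1 hM with rfl | hM
          · exact ⟨hf, hx⟩
          · exact absurd hx (hq.2 M hM hf)
      rw [if_pos hf]
      exact exists_le_insertLightest (.inl rfl)

theorem sound_extendAll (h : ∀ c ∈ cs, Valid l D c) :
    Sound l (L :: D) (extendAll stp l D L cs) := by
  induction cs with
  | nil => simp [Sound, extendAll]
  | cons c cs ih =>
    exact sound_extendBy (fun _ h => h) (h c (by simp)) (ih fun x hx => h x (by simp [hx]))

theorem exists_le_extendAll {L' : Layer α w} (hc : c ∈ cs) (hl : L' ∈ l) (hf : Fits L c L') :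
    ∃ y ∈ extendAll stp l D L cs, key (L :: D) y = key (L :: D) (L' :: c) ∧
      weight stp y ≤ weight stp (L' :: c) := by
  induction cs with
  | nil => simp at hc
  | cons d cs ih =>
    rcases List.mem_cons.1 hc with rfl | hc
    · exact exists_le_extendBy (.inr ⟨L', hl, hf, rfl⟩)
    · obtain ⟨y, hy, h₁, h₂⟩ := ih hc
      obtain ⟨z, hz, h₃, h₄⟩ := exists_le_extendBy (stp := stp) (L := L) (D := D) (c := d)
        (ls := l) (.inl hy)
      exact ⟨z, hz, h₃.trans h₁, h₄.trans h₂⟩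

theorem sound_solve (D : List (Layer α w)) : Sound l D (solve stp l D) := by
  induction D with
  | nil => simp [Sound, solve, Valid]
  | cons L D ih => exact sound_extendAll ih.1

/-- Optimal substructure: the tail of `c` is exchanged for the string kept for its key. Its first
layer still fits and yields the same key, and monotonicity keeps the result no heavier. -/
theorem exists_le_solve (hs : ∀ L, Monotone (stp L)) (h : Valid l D c) :
    ∃ y ∈ solve stp l D, key D y = key D c ∧ weight stp y ≤ weight stp c := by
  induction D generalizing c with
  | nil =>
    cases c with
    | nil => exact ⟨[], by simp [solve]⟩
    | cons M c => simp [Valid] at h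
  | cons L D ih =>
    cases c with
    | nil => simp [Valid] at h
    | cons L' c =>
      obtain ⟨hl, hf, hc⟩ := h
      obtain ⟨y, hy, h₁, h₂⟩ := ih hc
      have hv := (sound_solve D).1 y hy
      obtain ⟨z, hz, h₃, h₄⟩ := exists_le_extendAll (stp := stp) (D := D) hy hl
        (hf.congr hc hv h₁.symm)
      exact ⟨z, hz, h₃.trans (key_cons_congr hv hc h₁), h₄.trans (hs L' h₂)⟩

/-- A lightest string of layers from `l` with the same language as `D`, if there is one. -/
noncomputable def solution (stp : Layer α w → ℕ → ℕ) (l D : List (Layer α w)) :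
    Option (List (Layer α w)) :=
  lightest (fun c => rlang D (firstInit D) = rlang c (firstInit c)) (weight stp) (solve stp l D)

variable {S : Set (Layer α w)} {k : ℕ}

theorem solution_eq_some (hs : ∀ L, Monotone (stp L)) (hl : ∀ L, L ∈ l ↔ L ∈ S)
    (hD : D ∈ oddsOfLength Set.univ k) (hk : 0 < k) (h : solution stp l D = some c) :
    c ∈ oddsOfLength S k ∧ IsMinimizer (weight stp) S D c := by
  obtain ⟨hc, hr, hmin⟩ := lightest_eq_some h
  have hm := (valid_iff_mem_oddsOfLength hl hD).1 ((sound_solve D).1 c hc)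
  refine ⟨hm, ⟨k, hk, hm⟩, ?_, ?_⟩
  · rw [lang_eq, lang_eq, hr, hm.2.1, hD.2.1]
  · rintro c' ⟨k', hk', hc'⟩ hlang
    -- The language contains the length, so a competitor of any length has length `k`.
    rw [lang_eq, lang_eq, Prod.mk.injEq, hc'.2.1, hD.2.1] at hlang
    obtain ⟨rfl, hlang⟩ := hlang
    have hv := (valid_iff_mem_oddsOfLength hl hD).2 hc'
    obtain ⟨y, hy, h₁, h₂⟩ := exists_le_solve hs hv
    refine (hmin y hy ?_).trans h₂
    have hv' := (sound_solve D).1 y hy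
    have hne : D ≠ [] := hD.1.ne_nil
    obtain ⟨M, d, rfl⟩ := List.exists_cons_of_ne_nil (mt hv.eq_nil_iff.2 hne)
    obtain ⟨N, e, rfl⟩ := List.exists_cons_of_ne_nil (mt hv'.eq_nil_iff.2 hne)
    -- The kept string shares with the competitor both the relation and the initial states, hence
    -- also the language.
    rw [rlang_iff_of_key_eq (by simp) (by simp) h₁, ← hlang]
    simp only [key, Data.cons.injEq] at h₁
    simp only [firstInit, encodeStates_injective h₁.2.1]

theorem solution_eq_none (hs : ∀ L, Monotone (stp L)) (hl : ∀ L, L ∈ l ↔ L ∈ S)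
    (hD : D ∈ oddsOfLength Set.univ k) (h : solution stp l D = none) :
    ¬ ∃ D' ∈ oddsOfLength S k, lang D' = lang D := by
  rintro ⟨c', hc', hlang⟩
  rw [lang_eq, lang_eq, Prod.mk.injEq] at hlang
  have hv := (valid_iff_mem_oddsOfLength hl hD).2 hc'
  obtain ⟨y, hy, h₁, -⟩ := exists_le_solve hs hv
  refine lightest_eq_none h y hy ?_
  have hv' := (sound_solve D).1 y hy
  have hne : D ≠ [] := hD.1.ne_nil
  obtain ⟨M, d, rfl⟩ := List.exists_cons_of_ne_nil (mt hv.eq_nil_iff.2 hne)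
  obtain ⟨N, e, rfl⟩ := List.exists_cons_of_ne_nil (mt hv'.eq_nil_iff.2 hne)
  rw [rlang_iff_of_key_eq (by simp) (by simp) h₁, ← hlang.2]
  simp only [key, Data.cons.injEq] at h₁
  simp only [firstInit, encodeStates_injective h₁.2.1]

theorem solution_spec (hs : ∀ L, Monotone (stp L)) (hk : 0 < k)
    (hD : D ∈ oddsOfLength Set.univ k) (hl : Presents l S) :
    ((∃ D' ∈ oddsOfLength S k, lang D' = lang D) ∧ ∃ c, solution stp l D = some c ∧ c ≠ [] ∧
      IsMinimizer (weight stp) S D c) ∨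
    ((¬ ∃ D' ∈ oddsOfLength S k, lang D' = lang D) ∧ solution stp l D = none) := by
  cases h : solution stp l D with
  | none => exact .inr ⟨solution_eq_none hs hl.2 hD h, rfl⟩
  | some c =>
    obtain ⟨h₁, h₂⟩ := solution_eq_some hs hl.2 hD hk h
    exact .inl ⟨⟨c, h₁, h₂.2.1⟩, c, rfl, h₁.1.ne_nil, h₂⟩

end Solve

end ODD

namespace ODD
open Prog
open scoped Classical

/-! ### Running times of the functions on sets of states, layers and configurations -/

section Run

variable {m wt : Expr} {α : Type*} [Fintype α] [LinearOrder α] {w : ℕ}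

theorem length_letters (α : Type*) [Fintype α] [LinearOrder α] :
    (letters α).length = Fintype.card α := by
  simp [letters]

theorem mem_letters (a : α) : a ∈ letters α := by
  simp [letters]

/-- The components of a layer as data. -/
def layerComps (L : Layer α w) : List Data :=
  [encodeStates L.left, encodeStates L.right, encodeTransitions L.trans,
    encodeStates L.init, encodeStates L.fin, .ofBool L.initFlag, .ofBool L.finFlag]

theorem Within.comp_ofList {P : Program} {env : List Data} {e : Expr} {s : ℕ} {l : List Data}
    (h : Within P env e (.ofList l) s) (i : ℕ) :
    Within P env (comp e i) (l.getD i .nil) (s + i + 1) := by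
  induction i generalizing e s l with
  | zero => exact (Within.fst h).conv (by cases l <;> rfl) (by omega)
  | succ i ih =>
    cases l with
    | nil => exact (ih (l := []) (Within.snd h)).conv (by simp) (by omega)
    | cons a l => exact (ih (l := l) (Within.snd h)).conv (by simp) (by omega)

theorem Within.comp {P : Program} {env : List Data} {e : Expr} {s : ℕ} (L : Layer α w) (i : ℕ)
    (h : Within P env e (encodeLayer L) s) :
    Within P env (comp e i) ((layerComps L).getD i .nil) (s + i + 1) :=
  Within.comp_ofList (l := layerComps L) h i

/-- The empty sets of successors, for all letters. -/
def noSuccs (α : Type*) [Fintype α] [LinearOrder α] (w : ℕ) : Data :=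
  .ofList ((letters α).map fun _ => bits (fun _ => false) (List.finRange w))

/-- The sets of successors for the given letters. -/
noncomputable def encodePost (T : Finset (Fin w × α × Fin w)) (A : Finset (Fin w))
    (as : List α) : Data :=
  .ofList (as.map fun a => encodeStates (post T A a))

theorem calls_post (T : Finset (Fin w × α × Fin w)) (A : Finset (Fin w)) :
    Calls (prog m wt) fSucc
      (.cons (noSuccs α w) (.cons (encodeStates A) (encodeTransitions T)))
      (encodePost T A (letters α)) (tSucc w (Fintype.card α)) := by
  refine (calls_succ (fun p => decide (p ∈ A)) (fun p a q => decide ((p, a, q) ∈ T))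
    (List.finRange w) (letters α) (List.finRange w)).conv ?_ ?_
  · unfold encodePost encodeStates bits
    congr 2
    funext a
    congr 2
    funext q
    rw [Data.ofBool_inj, Bool.eq_iff_iff]
    simp [post]
  · simp [length_letters, tSucc]

theorem calls_inter (A B : Finset (Fin w)) :
    Calls (prog m wt) fMeets (.cons (encodeStates A) (encodeStates B))
      (.ofBool (decide (A ∩ B).Nonempty)) (30 * (w + 1)) := by
  refine (calls_meets (fun p => decide (p ∈ A)) (fun p => decide (p ∈ B))
    (List.finRange w)).conv ?_ (by simp)
  rw [Data.ofBool_inj, Bool.eq_iff_iff]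
  simp [Finset.Nonempty]

/-- The letter `a` leads to equivalent sets, for `E` the pairs of equivalent sets behind the
layers. -/
def Agree (L L' : Layer α w) (E : List Data) (A B : Finset (Fin w)) (a : α) : Prop :=
  if L.finFlag = true then
    ((post L.trans A a ∩ L.fin).Nonempty ↔ (post L'.trans B a ∩ L'.fin).Nonempty)
  else encodePair (post L.trans A a, post L'.trans B a) ∈ E

/-- What `fCheck` needs to know. -/
def encodeTest (L L' : Layer α w) (E : List Data) : Data :=
  .cons (.ofBool L.finFlag) (.cons (.cons (encodeStates L.fin) (encodeStates L'.fin)) (.ofList E))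

/-- Time to check one letter. -/
def tTest (w n : ℕ) : ℕ := 60 * (w + 1) + (30 * (8 * w + 3) + 30) * (n + 1) + 300

/-- The last layer compares acceptance, any other layer looks up a pair; both tests yield a truth
value, so the inner conditional can be treated as the single bit `Agree`. -/
theorem calls_check (L L' : Layer α w) (E : List Data) (A B : Finset (Fin w)) (as : List α) :
    Calls (prog m wt) fCheck
      (.cons (encodeTest L L' E) (.cons (encodePost L.trans A as) (encodePost L'.trans B as)))
      (.ofBool (decide (∀ a ∈ as, Agree L L' E A B a))) (tTest w E.length * (as.length + 1)) := by
  induction as with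
  | nil =>
    exact Within.conv (a := checkBody) (.iteNil (.fst (.snd .var)) rfl .one) (by simp)
      (by simp [tTest])
  | cons a as ih =>
    have hrec : Within (prog m wt) [.cons (encodeTest L L' E)
        (.cons (encodePost L.trans A (a :: as)) (encodePost L'.trans B (a :: as)))]
        (.call fCheck (.cons (.fst arg) (.cons (.snd (.fst (.snd arg))) (.snd (.snd (.snd arg))))))
        _ _ :=
      .call (.cons (.fst .var) (.cons (.snd (.fst (.snd .var))) (.snd (.snd (.snd .var))))) ih
    have hs := Nat.mul_le_mul_right (E.length + 1) (Nat.add_le_add_right (Nat.mul_le_mul_left 30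
      (size_encodePair_le (post L.trans A a, post L'.trans B a))) 30)
    have hb := Data.size_ofBool (decide (post L.trans A a ∩ L.fin).Nonempty)
    refine Within.conv (a := checkBody)
      (.iteCons (.fst (.snd .var)) rfl
        (.iteBool (q := decide (Agree L L' E A B a))
          (.iteBool (.fst (.fst .var)) rfl
            (fun _ => .call (.cons
              (.call (.cons (.fst (.fst (.snd .var))) (.fst (.fst (.snd (.fst .var)))))
                (calls_inter (post L.trans A a) L.fin))
              (.call (.cons (.fst (.snd (.snd .var))) (.snd (.fst (.snd (.fst .var)))))
                (calls_inter (post L'.trans B a) L'.fin)))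
              (calls_eq _ _))
            (fun _ => .call (.cons (.cons (.fst (.fst (.snd .var))) (.fst (.snd (.snd .var))))
              (.snd (.snd (.fst .var))))
              (calls_mem (encodePair (post L.trans A a, post L'.trans B a)) E)))
          ?_ (fun _ => hrec) (fun _ => .nil))) ?_ ?_
    · by_cases h : L.finFlag = true
      · simp [Agree, h, Data.ofBool_inj]
      · simp [Agree, h]
    · by_cases h : Agree L L' E A B a <;> simp [h, Data.ofBool]
    · simp only [List.length_cons, Nat.mul_succ _ (as.length + 1)]
      have : tTest w E.length = 60 * (w + 1) + (30 * (8 * w + 3) + 30) * (E.length + 1) + 300 := rfl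
      omega

/-- Time to find the pairs of equivalent sets among `n` ones. -/
def tFilter (w s n : ℕ) : ℕ :=
  (tTest w (2 ^ w * 2 ^ w) * (s + 1) + 2 * tSucc w s + 200) * (n + 1)

theorem calls_filter (L L' : Layer α w) (E : List Data) (hE : E.length ≤ 2 ^ w * 2 ^ w)
    (qs : List (Finset (Fin w) × Finset (Fin w))) :
    Calls (prog m wt) fFilter
      (.cons (.cons (noSuccs α w) (.cons
        (.cons (encodeTransitions L.trans) (encodeTransitions L'.trans)) (encodeTest L L' E)))
        (.ofList (qs.map encodePair)))
      (.ofList ((qs.filter fun q => decide (∀ a ∈ letters α, Agree L L' E q.1 q.2 a)).map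
        encodePair))
      (tFilter w (Fintype.card α) qs.length) := by
  induction qs with
  | nil =>
    exact Within.conv (a := filterBody) (.iteNil (.snd .var) rfl .nil) rfl
      (by simp [tFilter])
  | cons q qs ih =>
    refine Within.conv (a := filterBody)
      (.iteCons (.snd .var) rfl (.letIn (.call (.cons (.fst .var) (.snd (.snd .var))) ih)
        (.iteBool
          (.call (.cons (.snd (.snd (.fst .var)))
            (.cons
              (.call (.cons (.fst (.fst .var)) (.cons (.fst (.fst (.snd .var)))
                (.fst (.fst (.snd (.fst .var)))))) (calls_post L.trans q.1))
              (.call (.cons (.fst (.fst .var)) (.cons (.snd (.fst (.snd .var)))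
                (.snd (.fst (.snd (.fst .var)))))) (calls_post L'.trans q.2))))
            (calls_check L L' E q.1 q.2 (letters α)))
          rfl (fun _ => .cons (.fst (.snd .var)) .var) (fun _ => .var)))) ?_ ?_
    · simp only [List.filter_cons]
      cases decide (∀ a ∈ letters α, Agree L L' E q.1 q.2 a) <;> rfl
    -- Makes the time for one pair independent of `E`.
    · have h : tTest w E.length ≤ tTest w (2 ^ w * 2 ^ w) := by unfold tTest; gcongr
      have h' := Nat.mul_le_mul_right (Fintype.card α + 1) h
      simp only [tFilter, List.length_cons, Nat.mul_succ _ (qs.length + 1), length_letters]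
      omega

variable {stp : Layer α w → ℕ → ℕ} {l D c : List (Layer α w)} {L L' : Layer α w} {W : ℕ}

/-- This is `rlang_cons_eq_iff` with the final flag telling whether anything follows and with
equivalences looked up among the pairs of the key. The order of pairs agrees as well, so the program
produces the key itself. -/
theorem filter_agree (hD : FinalLast (L :: D)) (hc : Valid l D c) :
    ((statePairs w).filter fun q =>
      decide (∀ a ∈ letters α, Agree L L' (keyPairs D c) q.1 q.2 a)).map encodePair = equivalentPairs (L :: D) (L' :: c) := by
  unfold equivalentPairs
  congr 2
  funext q
  rw [decide_eq_decide, rlang_cons_eq_iff hc.eq_nil_iff]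
  simp only [mem_letters, forall_true_left, Agree, hD.head]
  refine forall_congr' fun a => ?_
  split_ifs with h
  · rfl
  · rw [keyPairs, if_neg (mt hc.eq_nil_iff.2 h), mem_equivalentPairs]

/-- A string of layers with its key and weight. -/
noncomputable def encodeConfig (stp : Layer α w → ℕ → ℕ) (D c : List (Layer α w)) : Data :=
  .cons (key D c) (.cons (.ofNat (weight stp c)) (encodeLayers c))

/-- Time to insert a configuration. -/
def tInsert (w W n : ℕ) : ℕ := (30 * keySize w + 20 * (W + 1) + 100) * (n + 1)

/-- Only keys and weights are inspected. The path is passed on as a pointer, so its length does not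
enter the time. -/
theorem calls_insert (hW : weight stp c ≤ W) (cs : List (List (Layer α w))) :
    Calls (prog m wt) fInsert
      (.cons (encodeConfig stp D c) (.ofList (cs.map (encodeConfig stp D))))
      (.ofList ((insertLightest (key D) (weight stp) c cs).map (encodeConfig stp D)))
      (tInsert w W cs.length) := by
  induction cs with
  | nil =>
    exact Within.conv (a := insertBody) (.iteNil (.snd .var) rfl (.cons (.fst .var) .nil)) rfl
      (by simp only [tInsert, List.length_nil]; omega)
  | cons d cs ih =>
    refine Within.conv (a := insertBody)
      (.iteCons (.snd .var) rfl
        (.iteBool (.call (.cons (.fst (.fst .var)) (.fst (.fst (.snd .var))))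
            (calls_eq (key D c) (key D d))) rfl
          (fun _ => .iteBool
            (.call (.cons (.fst (.snd (.fst .var))) (.fst (.snd (.fst (.snd .var)))))
              (calls_le (weight stp c) (weight stp d))) rfl
            (fun _ => .cons (.fst .var) (.snd (.snd .var)))
            (fun _ => .snd .var))
          (fun _ => .cons (.fst (.snd .var))
            (.call (.cons (.fst .var) (.snd (.snd .var))) ih)))) ?_ ?_
    · by_cases h : key D c = key D d
      · by_cases h' : weight stp c ≤ weight stp d
        · simp only [h, h', decide_true, if_true, insertLightest]
          rfl
        · simp only [h, h', decide_true, decide_false, Bool.false_eq_true, if_true, if_false,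
            insertLightest]
          rfl
      · simp only [h, decide_false, Bool.false_eq_true, if_false, insertLightest]
        rfl
    · have := size_key_le D c
      simp only [tInsert, List.length_cons, Nat.mul_succ _ (cs.length + 1)]
      omega

theorem tInsert_mono {n n' : ℕ} (w W : ℕ) (h : n ≤ n') : tInsert w W n ≤ tInsert w W n' := by
  unfold tInsert
  gcongr

/-- Time to extend a configuration by `n` layers. -/
def tExtend (w s W t n : ℕ) : ℕ :=
  (tFilter w s (2 ^ w * 2 ^ w) + tInsert w W (keyCount w) + t + 120 * w + 1000) * (n + 1)

/-- The function `fWeight` maps weights up to `W` as `stp` does, within time `t`. -/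
def Weighs (P : Program) (stp : Layer α w → ℕ → ℕ) (W t : ℕ) : Prop :=
  ∀ L n, n ≤ W → Calls P fWeight (.cons (encodeLayer L) (.ofNat n)) (.ofNat (stp L n)) t

/-- What does not depend on the diagram. -/
def globals (α : Type*) [Fintype α] [LinearOrder α] (w : ℕ) : Data :=
  .cons (noSuccs α w) (.ofList ((statePairs w).map encodePair))

/-- Soundness of the accumulated list is needed for the time rather than for the value: distinct
keys bound its length by `keyCount w`, and with it the cost of each insertion. -/
theorem calls_extendBy {t : ℕ} (ht : Weighs (prog m wt) stp W t) (hD : FinalLast (L :: D))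
    (hc : Valid l D c) (hW : ∀ x : List (Layer α w), x.length ≤ D.length + 1 → weight stp x ≤ W)
    {acc : List (List (Layer α w))} (hacc : Sound l (L :: D) acc) (ls : List (Layer α w))
    (hls : ∀ M ∈ ls, M ∈ l) :
    Calls (prog m wt) fLayers
      (.cons (.cons (globals α w) (.cons (encodeLayer L) (encodeConfig stp D c)))
        (.cons (encodeLayers ls) (.ofList (acc.map (encodeConfig stp (L :: D))))))
      (.ofList ((extendBy stp D L c acc ls).map (encodeConfig stp (L :: D))))
      (tExtend w (Fintype.card α) W t ls.length) := by
  induction ls with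
  | nil =>
    exact Within.conv (a := layersBody) (.iteNil (.fst (.snd .var)) rfl (.snd (.snd .var))) rfl
      (by simp only [tExtend, List.length_nil]; omega)
  | cons L' ls ih =>
    have hls' : ∀ M ∈ ls, M ∈ l := fun M hM => hls M (by simp [hM])
    have hs := sound_extendBy (stp := stp) hls' hc hacc
    have hlen := tInsert_mono w W (length_le_keyCount hs.1 hs.2)
    have hsz := size_encodeStates_le L'.right
    have hb₁ := Data.size_ofBool L.initFlag
    have hb₂ := Data.size_ofBool L.finFlag
    have hwc : weight stp c ≤ W := hW c (by rw [hc.length_eq]; omega)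
    have hwc' : weight stp (L' :: c) ≤ W := hW _ (by rw [List.length_cons, hc.length_eq])
    have hfil := calls_filter (m := m) (wt := wt) L L' (keyPairs D c) (length_keyPairs_le D c)
      (statePairs w)
    -- The pairs take the form in which the program finds them, as a component of the key of `c`.
    rw [filter_agree hD hc, length_statePairs, encodeTest, ← snd_snd_key] at hfil
    refine Within.conv (a := layersBody)
      (.iteCons (.fst (.snd .var)) rfl (.letIn
        (.call (.cons (.fst .var) (.cons (.snd (.fst (.snd .var))) (.snd (.snd .var)))) (ih hls'))
        (.iteBool (.call (.cons (.comp L 5 (.fst (.snd (.fst .var))))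
            (.comp L' 5 (.fst (.fst (.snd .var)))))
            (calls_eq (.ofBool L.initFlag) (.ofBool L'.initFlag))) rfl
          (fun _ => .iteBool (.call (.cons (.comp L 6 (.fst (.snd (.fst .var))))
            (.comp L' 6 (.fst (.fst (.snd .var)))))
            (calls_eq (.ofBool L.finFlag) (.ofBool L'.finFlag))) rfl
            (fun _ => .iteBool (q := decide (L.finFlag = true ∨
                encodeStates L'.right = (key D c).fst))
              (.iteBool (q := L.finFlag) (.comp L 6 (.fst (.snd (.fst .var)))) rfl (fun _ => .one)
                (fun _ => .call (.cons (.comp L' 1 (.fst (.fst (.snd .var))))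
                  (.fst (.fst (.snd (.snd (.fst .var))))))
                  (calls_eq (encodeStates L'.right) (key D c).fst)))
              ?_
              (fun _ => .call (.cons
                (.cons
                  (.cons (.comp L' 0 (.fst (.fst (.snd .var))))
                    (.cons (.comp L' 3 (.fst (.fst (.snd .var))))
                    (.call (.cons
                      (.cons (.fst (.fst (.fst .var)))
                        (.cons (.cons (.comp L 2 (.fst (.snd (.fst .var))))
                          (.comp L' 2 (.fst (.fst (.snd .var)))))
                        (.cons (.comp L 6 (.fst (.snd (.fst .var))))
                          (.cons (.cons (.comp L 4 (.fst (.snd (.fst .var))))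
                            (.comp L' 4 (.fst (.fst (.snd .var)))))
                          (.snd (.snd (.fst (.snd (.snd (.fst .var))))))))))
                      (.snd (.fst (.fst .var)))) hfil)))
                  (.cons (.call (.cons (.fst (.fst (.snd .var)))
                      (.fst (.snd (.snd (.snd (.fst .var)))))) (ht L' (weight stp c) hwc))
                    (.cons (.fst (.fst (.snd .var))) (.snd (.snd (.snd (.snd (.fst .var))))))))
                .var) (calls_insert (D := L :: D) (c := L' :: c) hwc' _))
              (fun _ => .var))
            (fun _ => .var))
          (fun _ => .var)))) ?_ ?_
    · by_cases h : L.finFlag = true <;> simp [h]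
    · rw [extendBy]
      by_cases hf : Fits L c L'
      · obtain ⟨h₁, h₂, h₃⟩ := (fits_iff hD hc).1 hf
        simp only [if_pos hf, h₃, decide_true, if_true]
        simp only [h₁, h₂, decide_true, if_true]
      · rw [if_neg hf]
        rw [fits_iff hD hc] at hf
        by_cases h₁ : L.initFlag = L'.initFlag
        · by_cases h₂ : L.finFlag = L'.finFlag
          · have h₃ : ¬ (L.finFlag = true ∨ encodeStates L'.right = (key D c).fst) :=
              fun h => hf ⟨h₁, h₂, h⟩
            simp only [h₃, decide_false, Bool.false_eq_true, if_false]
            simp only [h₁, h₂, decide_true, if_true]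
            rfl
          · simp only [h₁, h₂, Data.ofBool_inj, decide_true, decide_false, Bool.false_eq_true,
              if_true, if_false]
            rfl
        · simp only [h₁, Data.ofBool_inj, decide_false, Bool.false_eq_true, if_false]
          rfl
    · simp only [tExtend, List.length_cons, Nat.mul_succ _ (ls.length + 1)]
      omega

end Run

end ODD

namespace ODD
open Prog
open scoped Classical

/-! ### The dynamic program over a whole diagram -/

section Main

variable {m wt : Expr} {α : Type*} [Fintype α] [LinearOrder α] {w : ℕ}
  {stp : Layer α w → ℕ → ℕ} {l D : List (Layer α w)} {L : Layer α w} {W t : ℕ}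

theorem calls_extendAll (ht : Weighs (prog m wt) stp W t) (hD : FinalLast (L :: D))
    (hW : ∀ x : List (Layer α w), x.length ≤ D.length + 1 → weight stp x ≤ W)
    (cs : List (List (Layer α w))) (hcs : ∀ c ∈ cs, Valid l D c) :
    Calls (prog m wt) fConfigs
      (.cons (.cons (globals α w) (.cons (encodeLayer L) (encodeLayers l)))
        (.ofList (cs.map (encodeConfig stp D))))
      (.ofList ((extendAll stp l D L cs).map (encodeConfig stp (L :: D))))
      ((tExtend w (Fintype.card α) W t l.length + 100) * (cs.length + 1)) := by
  induction cs with
  | nil =>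
    exact Within.conv (a := configsBody) (.iteNil (.snd .var) rfl .nil) rfl (by simp)
  | cons c cs ih =>
    have hcs' : ∀ x ∈ cs, Valid l D x := fun x hx => hcs x (by simp [hx])
    exact Within.conv (a := configsBody)
      (.iteCons (.snd .var) rfl (.call (.cons
        (.cons (.fst (.fst .var)) (.cons (.fst (.snd (.fst .var))) (.fst (.snd .var))))
        (.cons (.snd (.snd (.fst .var))) (.call (.cons (.fst .var) (.snd (.snd .var))) (ih hcs'))))
        (calls_extendBy ht hD (hcs c (by simp)) hW (sound_extendAll hcs') l fun _ h => h)))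
      rfl (by simp only [List.length_cons, Nat.mul_succ _ (cs.length + 1)]; omega)

/-- Time to find the lightest strings of layers for all keys. -/
def tSolve (w s W t n k : ℕ) : ℕ :=
  ((tExtend w s W t n + 100) * (keyCount w + 1) + 100) * (k + 1)

/-- The hypotheses are stated for `FinalLast` and for all shorter strings so that they pass to
suffixes of `D`. -/
theorem calls_solve (ht : Weighs (prog m wt) stp W t) (hD : FinalLast D)
    (hW : ∀ x : List (Layer α w), x.length ≤ D.length → weight stp x ≤ W) :
    Calls (prog m wt) fSolve (.cons (.cons (globals α w) (encodeLayers l)) (encodeLayers D))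
      (.ofList ((solve stp l D).map (encodeConfig stp D)))
      (tSolve w (Fintype.card α) W t l.length D.length) := by
  induction D with
  | nil =>
    exact Within.conv (a := solveBody)
      -- The single configuration of the empty string, with key, weight 0 and path all `.nil`.
      (.iteNil (.snd .var) rfl (.cons (.cons .nil (.cons .nil .nil)) .nil)) rfl
      (by simp only [tSolve, List.length_nil]; omega)
  | cons L D ih =>
    have ih := ih hD.tail fun x hx => hW x (by simp; omega)
    have hs := sound_solve (stp := stp) (l := l) D
    have hlen := Nat.mul_le_mul_left (tExtend w (Fintype.card α) W t l.length + 100)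
      (Nat.add_le_add_right (length_le_keyCount hs.1 hs.2) 1)
    exact Within.conv (a := solveBody)
      (.iteCons (.snd .var) rfl (.call (.cons
        (.cons (.fst (.fst .var)) (.cons (.fst (.snd .var)) (.snd (.fst .var))))
        (.call (.cons (.fst .var) (.snd (.snd .var))) ih))
        (calls_extendAll ht hD hW _ hs.1)))
      rfl (by simp only [tSolve, List.length_cons, Nat.mul_succ _ (D.length + 1)] at hlen ⊢; omega)

/-- Time to find the lightest string of layers with the right language. -/
def tBest (w W n : ℕ) : ℕ :=
  ((30 * (8 * w + 3) + 30) * (2 ^ w * 2 ^ w + 1) + 20 * (W + 1) + 200) * (n + 1)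

/-- A configuration is a cell, so `.nil` can stand for having found none. The property `ok` is
abstract because the program tests membership of a pair in the stored key. -/
theorem calls_best (cs : List (List (Layer α w))) (hcs : ∀ c ∈ cs, c ≠ [] ∧ weight stp c ≤ W)
    (I : Finset (Fin w)) (ok : List (Layer α w) → Prop)
    (hok : ∀ c, ok c ↔ encodePair (I, firstInit c) ∈ equivalentPairs D c) :
    Calls (prog m wt) fBest
      (.cons (encodeStates I) (.ofList (cs.map (encodeConfig stp D))))
      (((lightest ok (weight stp) cs).map (encodeConfig stp D)).getD .nil)
      (tBest w W cs.length) := by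
  induction cs with
  | nil =>
    exact Within.conv (a := bestBody) (.iteNil (.snd .var) rfl .nil) rfl
      (by simp only [tBest, List.length_nil]; omega)
  | cons c cs ih =>
    have ih := ih fun x hx => hcs x (by simp [hx])
    obtain ⟨hne, hw⟩ := hcs c (by simp)
    obtain ⟨M, c, rfl⟩ := List.exists_cons_of_ne_nil hne
    have hok' : ok (M :: c) ↔ encodePair (I, M.init) ∈ equivalentPairs D (M :: c) := hok _
    have hsz := Nat.mul_le_mul_right (2 ^ w * 2 ^ w + 1) (Nat.add_le_add_right
      (Nat.mul_le_mul_left 30 (size_encodePair_le (I, M.init))) 30)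
    have hE : (equivalentPairs D (M :: c)).length ≤ 2 ^ w * 2 ^ w := by
      simpa [keyPairs] using length_keyPairs_le D (M :: c)
    have hsz' := Nat.mul_le_mul_left (30 * (encodePair (I, M.init)).size + 30)
      (Nat.add_le_add_right hE 1)
    cases hl : lightest ok (weight stp) cs with
    | none =>
      rw [hl] at ih
      refine Within.conv (a := bestBody)
        (.iteCons (.snd .var) rfl (.letIn (.call (.cons (.fst .var) (.snd (.snd .var))) ih)
          (.iteBool (.call (.cons
              (.cons (.fst .var) (.fst (.snd (.fst (.fst (.snd .var))))))
              (.snd (.snd (.fst (.fst (.snd .var))))))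
              (calls_mem (encodePair (I, M.init)) (equivalentPairs D (M :: c)))) rfl
            (fun _ => .iteNil .var rfl (.fst (.snd .var)))
            (fun _ => .var)))) ?_ ?_
      · simp only [← hok', lightest, hl]
        by_cases h : ok (M :: c)
        · simp only [h, decide_true, if_true]
          rfl
        · simp only [h, decide_false, Bool.false_eq_true, if_false]
          rfl
      · simp only [tBest, List.length_cons, Nat.mul_succ _ (cs.length + 1)]
        omega
    | some d =>
      rw [hl] at ih
      refine Within.conv (a := bestBody)
        (.iteCons (.snd .var) rfl (.letIn (.call (.cons (.fst .var) (.snd (.snd .var))) ih)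
          (.iteBool (.call (.cons
              (.cons (.fst .var) (.fst (.snd (.fst (.fst (.snd .var))))))
              (.snd (.snd (.fst (.fst (.snd .var))))))
              (calls_mem (encodePair (I, M.init)) (equivalentPairs D (M :: c)))) rfl
            (fun _ => .iteCons .var rfl (.iteBool (.call (.cons
              (.fst (.snd (.fst (.snd .var)))) (.fst (.snd .var)))
                (calls_le (weight stp (M :: c)) (weight stp d))) rfl
              (fun _ => .fst (.snd .var)) (fun _ => .var)))
            (fun _ => .var)))) ?_ ?_
      · simp only [← hok', lightest, hl]
        by_cases h : ok (M :: c)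
        · by_cases h' : weight stp (M :: c) ≤ weight stp d
          · simp only [h, h', decide_true, if_true]
            rfl
          · simp only [h, h', decide_true, decide_false, Bool.false_eq_true, if_true, if_false]
            rfl
        · simp only [h, decide_false, Bool.false_eq_true, if_false]
          rfl
      · simp only [tBest, List.length_cons, Nat.mul_succ _ (cs.length + 1)]
        omega

/-- Time to compute the optimal diagram. -/
def tOptimum (w s W t n k : ℕ) : ℕ :=
  20 * (w + 1) + 20 * (s + 1) + (30 * (2 ^ w + 1) + 20) * (w + 1) +
    (30 * (2 ^ w + 1) + 30) * (2 ^ w + 1) + tSolve w s W t n k + tBest w W (keyCount w) + 200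

theorem within_optimum (ht : Weighs (prog m wt) stp W t) (hne : D ≠ []) (hD : FinalLast D)
    (hW : ∀ x : List (Layer α w), x.length ≤ D.length → weight stp x ≤ W) :
    Within (prog m wt) [encodeInput D l] optimum (encodeLayers ((solution stp l D).getD []))
      (tOptimum w (Fintype.card α) W t l.length D.length) := by
  have hs := sound_solve (stp := stp) (l := l) D
  have hsubs := calls_subsets (m := m) (wt := wt) w
  rw [← map_encodeStates_subsets] at hsubs
  have hpairs := calls_pairs (m := m) (wt := wt) encodeStates encodeStates (subsets w) (subsets w)
  -- The bit `false` is `.nil`, so replicating `.nil` twice gives the table of empty sets.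
  have hz : Data.ofList (List.replicate (Fintype.card α) (.ofList (List.replicate w .nil))) =
      noSuccs α w := by
    simp [noSuccs, bits, length_letters, Data.ofBool]
  have hsolve := calls_solve (m := m) (wt := wt) (l := l) ht hD hW
  have hbest := calls_best (m := m) (wt := wt) (stp := stp) (W := W) (D := D) (solve stp l D)
    (fun c hc => ⟨mt (hs.1 c hc).eq_nil_iff.2 hne, hW c (hs.1 c hc).length_eq.le⟩) (firstInit D)
    (fun c => rlang D (firstInit D) = rlang c (firstInit c)) fun c => mem_equivalentPairs.symm
  have hlen : tBest w W (solve stp l D).length ≤ tBest w W (keyCount w) :=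
    Nat.mul_le_mul_left _ (Nat.add_le_add_right (length_le_keyCount hs.1 hs.2) 1)
  have hsl : (subsets w).length = 2 ^ w := by simp [subsets, length_bitLists]
  rw [globals, ← hz] at hsolve
  obtain ⟨L, D, rfl⟩ := List.exists_cons_of_ne_nil hne
  refine Within.conv (a := optimum)
    (.letIn (.call (.cons (.fst .var) (.call (.cons (.fst (.snd .var)) .nil)
        (calls_replicate w .nil))) (calls_replicate (Fintype.card α) _))
      (.letIn (.call (.fst (.snd .var)) hsubs)
        (.snd (.snd (.call (.cons (.comp L 3 (.fst (.fst (.snd (.snd .var)))))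
          (.call (.cons (.cons (.cons .var (.call (.cons .var .var) hpairs))
            (.fst (.snd (.snd (.snd .var))))) (.fst (.snd (.snd .var)))) hsolve)) hbest))))) ?_ ?_
  -- Taking components of `.nil` gives `.nil`, which encodes the empty string returned when there is
  -- no solution.
  · rw [solution]
    cases lightest (fun c => rlang (L :: D) (firstInit (L :: D)) = rlang c (firstInit c))
      (weight stp) (solve stp l (L :: D)) <;> rfl
  · simp only [tOptimum, hsl] at hlen ⊢
    omega

end Main

end ODD

namespace ODD
open Prog

/-! ### Weights -/

section Weights

variable {α : Type*} {w : ℕ}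

/-- The width of a layer followed by a string of layers of width `n`. -/
def widthStep (L : Layer α w) (n : ℕ) : ℕ := max n (max L.left.card L.right.card)

/-- The contribution of a layer to the number of states, added to `n`. -/
def stateStep (L : Layer α w) (n : ℕ) : ℕ :=
  L.right.card + if L.initFlag = true then L.left.card + n else n

/-- The number of transitions of a layer, added to `n`. -/
def transitionStep (L : Layer α w) (n : ℕ) : ℕ := L.trans.card + n

theorem monotone_widthStep (L : Layer α w) : Monotone (widthStep L) :=
  fun _ _ h => max_le_max_right _ h

theorem monotone_stateStep (L : Layer α w) : Monotone (stateStep L) := fun a b h => by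
  unfold stateStep
  split_ifs <;> omega

theorem monotone_transitionStep (L : Layer α w) : Monotone (transitionStep L) :=
  fun _ _ h => Nat.add_le_add_left h _

theorem card_le_width (A : Finset (Fin w)) : A.card ≤ w := by
  simpa using A.card_le_univ

theorem weight_widthStep_le (c : List (Layer α w)) : weight widthStep c ≤ w := by
  induction c with
  | nil => simp [weight]
  | cons L c ih =>
    exact max_le ih (max_le (card_le_width _) (card_le_width _))

theorem weight_le {stp : Layer α w → ℕ → ℕ} {C k : ℕ} (h : ∀ L n, stp L n ≤ C + n)
    {c : List (Layer α w)} (hc : c.length ≤ k) : weight stp c ≤ C * k := by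
  refine le_trans ?_ (Nat.mul_le_mul_left C hc)
  clear hc
  induction c with
  | nil => simp [weight]
  | cons L c ih =>
    have := h L (weight stp c)
    rw [List.length_cons, Nat.mul_succ]
    exact this.trans (by omega)

theorem stateStep_le (L : Layer α w) (n : ℕ) : stateStep L n ≤ 2 * w + n := by
  have h₁ := card_le_width L.left
  have h₂ := card_le_width L.right
  unfold stateStep
  split_ifs <;> omega

theorem transitionStep_le [Fintype α] (L : Layer α w) (n : ℕ) :
    transitionStep L n ≤ w * (Fintype.card α * w) + n := by
  have := L.trans.card_le_univ
  simp only [Fintype.card_prod, Fintype.card_fin] at this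
  exact Nat.add_le_add_right this _

/-- Each right frontier except the last is the left frontier of the next layer, so counting right
frontiers everywhere does not change the maximum. -/
theorem weight_widthStep {c : List (Layer α w)}
    (hc : c.IsChain (fun L L' => L'.left = L.right)) : weight widthStep c = width c := by
  induction c with
  | nil => simp [weight, width]
  | cons L c ih =>
    cases c with
    | nil => simp [weight, width, widthStep]
    | cons M c =>
      rw [List.isChain_cons_cons] at hc
      have := ih hc.2
      simp only [weight, width, widthStep, List.foldr_cons, List.map_cons,
        List.getLast?_cons_cons] at this ⊢
      rw [this, ← hc.1]
      omega

theorem weight_transitionStep (c : List (Layer α w)) :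
    weight transitionStep c = numTransitions c := by
  induction c with
  | nil => simp [weight, numTransitions]
  | cons L c ih => simpa [weight, numTransitions, transitionStep] using ih

theorem weight_stateStep_of_forall {c : List (Layer α w)} (h : ∀ L ∈ c, L.initFlag = false) :
    weight stateStep c = (c.map fun L => L.right.card).sum := by
  induction c with
  | nil => simp [weight]
  | cons L c ih =>
    have := ih fun M hM => h M (by simp [hM])
    rw [List.map_cons, List.sum_cons, ← this]
    simp [weight, stateStep, h L (by simp)]

/-- The initial flag marks the first layer only, so its left frontier is the only one counted. -/
theorem weight_stateStep {c : List (Layer α w)} (hc : IsODD c) :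
    weight stateStep c = numStates c := by
  obtain ⟨L, c, rfl⟩ := List.exists_cons_of_ne_nil hc.ne_nil
  have h₁ : L.initFlag = true := (hc.initFlag 0 (by simp)).2 rfl
  have h₂ : ∀ M ∈ c, M.initFlag = false := by
    intro M hM
    obtain ⟨i, hi, rfl⟩ := List.getElem_of_mem hM
    have := hc.initFlag (i + 1) (by simpa using hi)
    rw [List.getElem_cons_succ] at this
    simpa using this
  have := weight_stateStep_of_forall h₂
  rw [weight] at this
  simp only [weight, numStates, List.foldr_cons, this, stateStep, h₁, if_true, List.head?_cons,
    Option.map_some, Option.getD_some, List.map_cons, List.sum_cons]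
  omega

/-- Fold weights need not agree with the measures on arbitrary strings, but all competitors are
diagrams. -/
theorem IsMinimizer.congr {μ ν : List (Layer α w) → ℕ} {S : Set (Layer α w)}
    {D D' : List (Layer α w)} (h : IsMinimizer μ S D D') (hμ : ∀ c, IsODD c → μ c = ν c) :
    IsMinimizer ν S D D' := by
  refine ⟨h.1, h.2.1, fun c hc hlang => ?_⟩
  have := h.2.2 c hc hlang
  obtain ⟨_, _, h₁, -⟩ := h.1
  obtain ⟨_, _, h₂, -⟩ := hc
  rwa [hμ _ h₁, hμ _ h₂] at this

theorem countP_finRange (A : Finset (Fin w)) :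
    (List.finRange w).countP (fun p => decide (p ∈ A)) = A.card := by
  rw [List.countP_eq_length_filter,
    ← List.toFinset_card_of_nodup ((List.nodup_finRange w).filter _)]
  congr 1
  ext
  simp

end Weights

namespace Prog

/-- Computes `widthStep`. -/
def widthBody : Expr :=
  .call fMax (.cons (.snd arg) (.call fMax (.cons
    (.call fCount (.cons (comp (.fst arg) 0) .nil))
    (.call fCount (.cons (comp (.fst arg) 1) .nil)))))

/-- Computes `stateStep`. -/
def stateBody : Expr :=
  .call fCount (.cons (comp (.fst arg) 1)
    (.ite (comp (.fst arg) 5) (.call fCount (.cons (comp (.fst arg) 0) (.snd arg))) (.snd arg)))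

/-- Computes `transitionStep`. -/
def transitionBody : Expr :=
  .call fCountTable (.cons (comp (.fst arg) 2) (.snd arg))

end Prog

/-! ### Running times of the weight functions -/

section WeightTimes

variable {m wt : Expr} {α : Type*} [Fintype α] [LinearOrder α] {w : ℕ}

theorem calls_card (A : Finset (Fin w)) (n : ℕ) :
    Calls (prog m wt) fCount (.cons (encodeStates A) (.ofNat n)) (.ofNat (A.card + n))
      (20 * (w + 1)) :=
  (calls_count (fun p => decide (p ∈ A)) (List.finRange w) n).conv (by rw [countP_finRange])
    (by simp)

theorem sum_map_letters (f : α → ℕ) : ((letters α).map f).sum = ∑ a, f a := by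
  rw [letters, ← List.sum_toFinset f (Finset.sort_nodup _ _)]
  simp

theorem card_eq_sum_countP (T : Finset (Fin w × α × Fin w)) :
    ((List.finRange w).map fun p => ((letters α).map fun a =>
      (List.finRange w).countP fun q => decide ((p, a, q) ∈ T)).sum).sum = T.card := by
  have h (p : Fin w) (a : α) : (List.finRange w).countP (fun q => decide ((p, a, q) ∈ T)) =
      ∑ q, if (p, a, q) ∈ T then 1 else 0 := by
    rw [Finset.sum_boole, Nat.cast_id, ← countP_finRange]
    simp
  have hT : T.card = ∑ x, if x ∈ T then 1 else 0 := by
    rw [← Finset.card_filter, Finset.filter_univ_mem]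
  simp only [h, sum_map_letters, ← Fin.sum_univ_def, hT, Fintype.sum_prod_type]

theorem calls_cardTransitions (T : Finset (Fin w × α × Fin w)) (n : ℕ) :
    Calls (prog m wt) fCountTable (.cons (encodeTransitions T) (.ofNat n)) (.ofNat (T.card + n))
      (((20 * (w + 1) + 20) * (Fintype.card α + 1) + 20) * (w + 1)) :=
  (calls_countTable (fun p a q => decide ((p, a, q) ∈ T)) (List.finRange w) (letters α)
    (List.finRange w) n).conv (by rw [card_eq_sum_countP]) (by simp [length_letters])

/-- A maximum has to traverse the old weight, hence the dependence on `W`. -/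
theorem weighs_widthStep (W : ℕ) :
    Weighs (prog m widthBody) (widthStep (α := α) (w := w)) W (100 * (w + 1) + 20 * W + 200) := by
  intro L n hn
  have h₁ := card_le_width L.left
  refine Within.conv (a := widthBody)
    (.call (.cons (.snd .var) (.call (.cons
      (.call (.cons (.comp L 0 (.fst .var)) .nil) (calls_card L.left 0))
      (.call (.cons (.comp L 1 (.fst .var)) .nil) (calls_card L.right 0)))
      (calls_max L.left.card L.right.card))) (calls_max n (max L.left.card L.right.card)))
    rfl (by omega)

/-- New cells are put in front of the old weight, which is never traversed; the time does not
involve `W`. -/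
theorem weighs_stateStep (W : ℕ) :
    Weighs (prog m stateBody) (stateStep (α := α) (w := w)) W (100 * (w + 1) + 200) := by
  intro L n hn
  cases h : L.initFlag with
  | true =>
    refine Within.conv (a := stateBody)
      (.call (.cons (.comp L 1 (.fst .var)) (.iteCons (.comp L 5 (.fst .var))
        (show Data.ofBool L.initFlag = .cons .nil .nil by rw [h]; rfl)
        (.call (.cons (.comp L 0 (.fst .var)) (.snd .var)) (calls_card L.left n))))
        (calls_card L.right _)) (by simp [stateStep, h]) (by omega)
  | false =>
    refine Within.conv (a := stateBody)
      (.call (.cons (.comp L 1 (.fst .var)) (.iteNil (.comp L 5 (.fst .var))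
        (show Data.ofBool L.initFlag = .nil by rw [h]; rfl) (.snd .var)))
        (calls_card L.right n)) (by simp [stateStep, h]) (by omega)

theorem weighs_transitionStep (W : ℕ) :
    Weighs (prog m transitionBody) (transitionStep (α := α) (w := w)) W
      (((20 * (w + 1) + 20) * (Fintype.card α + 1) + 20) * (w + 1) + 100) := by
  intro L n hn
  exact Within.conv (a := transitionBody)
    (.call (.cons (.comp L 2 (.fst .var)) (.snd .var)) (calls_cardTransitions L.trans n))
    rfl (by omega)

end WeightTimes

/-! ### The total running time -/

section Bounds

theorem mul_succ_le {B C Y Z n : ℕ} (h : C ≤ Y) (hn : n + 1 ≤ B) (hZ : B * Y ≤ Z) :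
    C * (n + 1) ≤ Z :=
  (Nat.mul_le_mul h hn).trans (by rwa [Nat.mul_comm])

/-- Every loop runs at most `B` times and so costs one factor `B`; a further factor absorbs
constants and lower terms, since `B` is at least 4096. -/
theorem tOptimum_le {B w s W t n k : ℕ} (hB : 4096 ≤ B) (hw : w + 1 ≤ B) (hs : s + 1 ≤ B)
    (h2 : 2 ^ w * 2 ^ w + 1 ≤ B) (hK : keyCount w + 1 ≤ B) (hn : n + 1 ≤ B)
    (ht : t ≤ B ^ 5 * (W + 1)) (hk : 0 < k) : tOptimum w s W t n k ≤ B ^ 13 * ((W + 1) * k) := by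
  -- An opaque scale on which multiplication by `B` is a shift. Sums of terms at different heights
  -- then become linear problems for `omega`.
  obtain ⟨Y, hY⟩ : ∃ Y : ℕ → ℕ, ∀ i, Y i = B ^ i * (W + 1) := ⟨_, fun _ => rfl⟩
  have hYB i : B * Y i = Y (i + 1) := by rw [hY, hY]; ring
  have hst i : 4096 * Y i ≤ Y (i + 1) := hYB i ▸ Nat.mul_le_mul_right _ hB
  have hY0 : Y 0 = W + 1 := by simp [hY]
  have hY1 : B ≤ Y 1 := by rw [hY]; nlinarith
  have hlt : 2 ^ w ≤ 2 ^ w * 2 ^ w := Nat.le_mul_of_pos_right _ (by positivity)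
  have s0 := hst 0
  have s1 := hst 1
  have s2 := hst 2
  have s3 := hst 3
  have s4 := hst 4
  have s5 := hst 5
  have s6 := hst 6
  have s7 := hst 7
  have s8 := hst 8
  have s9 := hst 9
  have s10 := hst 10
  have s11 := hst 11
  simp only [Nat.reduceAdd] at s0 s1 s2 s3 s4 s5 s6 s7 s8 s9 s10 s11
  rw [← hY] at ht
  have hsucc : tSucc w s ≤ Y 5 := by
    have h := mul_succ_le (Z := Y 3) (C := 30 * (w + 1) + 30) (Y := Y 2) (by omega) hs (hYB 2).le
    exact mul_succ_le (Z := Y 5) (Y := Y 4) (by omega) hw (hYB 4).le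
  have hpair := mul_succ_le (Z := Y 3) (C := 30 * (8 * w + 3) + 30) (Y := Y 2) (by omega) h2
    (hYB 2).le
  have htest : tTest w (2 ^ w * 2 ^ w) ≤ Y 4 := by
    unfold tTest
    omega
  have hfil : tFilter w s (2 ^ w * 2 ^ w) ≤ Y 7 := by
    have h := mul_succ_le (Z := Y 5) htest hs (hYB 4).le
    exact mul_succ_le (Z := Y 7) (Y := Y 6) (by omega) h2 (hYB 6).le
  have hsize : keySize w ≤ Y 3 := by
    have h := mul_succ_le (Z := Y 3) (C := 8 * w + 4) (Y := Y 2) (by omega) h2 (hYB 2).le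
    have h' : (8 * w + 4) * (2 ^ w * 2 ^ w + 1) = (8 * w + 4) * (2 ^ w * 2 ^ w) + (8 * w + 4) :=
      Nat.mul_succ _ _
    have h'' := mul_succ_le (C := 8 * w + 4) (Y := 8 * B) (Z := Y 2 * 8) (by omega) h2
      (by have := hYB 1; nlinarith)
    unfold keySize
    omega
  have hins : tInsert w W (keyCount w) ≤ Y 5 :=
    mul_succ_le (Z := Y 5) (Y := Y 4) (by omega) hK (hYB 4).le
  have hext : tExtend w s W t n ≤ Y 9 := mul_succ_le (Z := Y 9) (Y := Y 8) (by omega) hn (hYB 8).le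
  have hsol : tSolve w s W t n k ≤ Y 11 * (k + 1) := by
    have h := mul_succ_le (C := tExtend w s W t n + 100) (Y := 2 * Y 9) (Z := 2 * Y 10) (by omega)
      hK (by rw [← hYB 9]; apply le_of_eq; ring)
    exact Nat.mul_le_mul_right _ (by omega)
  have hbest : tBest w W (keyCount w) ≤ Y 5 :=
    mul_succ_le (Z := Y 5) (Y := Y 4) (by omega) hK (hYB 4).le
  have hsub : (30 * (2 ^ w + 1) + 20) * (w + 1) ≤ Y 3 :=
    mul_succ_le (Z := Y 3) (Y := Y 2) (by omega) hw (hYB 2).le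
  have hprs : (30 * (2 ^ w + 1) + 30) * (2 ^ w + 1) ≤ Y 3 :=
    mul_succ_le (Z := Y 3) (Y := Y 2) (by omega) (by omega) (hYB 2).le
  have hfin : Y 12 ≤ Y 12 * k := Nat.le_mul_of_pos_right _ hk
  have h13 : B ^ 13 * ((W + 1) * k) = B * (Y 12 * k) := by rw [hY]; ring
  have hle : 4096 * (Y 12 * k) ≤ B * (Y 12 * k) := Nat.mul_le_mul_right _ hB
  have hk2 : Y 11 * (k + 1) ≤ Y 12 * (2 * k) := Nat.mul_le_mul (by omega) (by omega)
  have hk3 : Y 12 * (2 * k) = 2 * (Y 12 * k) := by ring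
  rw [h13]
  unfold tOptimum
  omega

variable {α : Type*} {w : ℕ}

/-- A layer is determined by four sets of states, two flags and a subset of the `w * |α| * w`
possible transitions. -/
theorem length_layers_le [Fintype α] {l : List (Layer α w)} (hl : l.Nodup) :
    l.length ≤ 2 ^ (4 * w + 2 + w * (Fintype.card α * w)) := by
  let f : Layer α w → (Finset (Fin w) × Finset (Fin w) × Finset (Fin w) × Finset (Fin w)) ×
      (Bool × Bool) × Finset (Fin w × α × Fin w) :=
    fun L => ((L.left, L.right, L.init, L.fin), (L.initFlag, L.finFlag), L.trans)
  have hf : Function.Injective f := by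
    intro L L' h
    simp only [f, Prod.mk.injEq] at h
    ext1 <;> tauto
  have h := (hl.map hf).length_le_card
  rw [List.length_map] at h
  refine h.trans_eq ?_
  simp only [Fintype.card_prod, Fintype.card_finset, Fintype.card_fin, Fintype.card_bool]
  rw [pow_add, pow_add, pow_mul']
  ring

/-- Everything that does not depend on the length is bounded by a power of two. -/
theorem parameters_le (s : ℕ) (hs : 0 < s) (hw : 0 < w) :
    4096 ≤ 2 ^ (6 * (s * w * 2 ^ w)) ∧ w + 1 ≤ 2 ^ (6 * (s * w * 2 ^ w)) ∧
      s + 1 ≤ 2 ^ (6 * (s * w * 2 ^ w)) ∧ 2 ^ w * 2 ^ w + 1 ≤ 2 ^ (6 * (s * w * 2 ^ w)) ∧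
      keyCount w + 1 ≤ 2 ^ (6 * (s * w * 2 ^ w)) ∧
      2 ^ (4 * w + 2 + w * (s * w)) + 1 ≤ 2 ^ (6 * (s * w * 2 ^ w)) := by
  obtain ⟨X, hX⟩ : ∃ X, X = s * w * 2 ^ w := ⟨_, rfl⟩
  have h1 : 2 ≤ 2 ^ w := by
    calc 2 = 2 ^ 1 := rfl
      _ ≤ 2 ^ w := Nat.pow_le_pow_right (by norm_num) hw
  have hww : w * 2 ^ w ≤ X := by rw [hX]; nlinarith [Nat.zero_le (w * 2 ^ w)]
  have hsw : s * w * 2 ≤ X := by rw [hX]; exact Nat.mul_le_mul_left _ h1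
  have h2w : w * 2 ≤ w * 2 ^ w := Nat.mul_le_mul_left _ h1
  have hs' : s ≤ s * w := Nat.le_mul_of_pos_right _ hw
  have hlt : w < 2 ^ w := Nat.lt_two_pow_self
  have h2' : 2 ^ w ≤ w * 2 ^ w := Nat.le_mul_of_pos_left _ hw
  have hwsw : w * (s * w) ≤ X := by
    rw [hX, Nat.mul_comm]
    exact Nat.mul_le_mul_left _ hlt.le
  have key {a e : ℕ} (ha : a ≤ 2 ^ e) (he : e + 1 ≤ 6 * X) : a + 1 ≤ 2 ^ (6 * X) := by
    calc a + 1 ≤ 2 ^ e + 2 ^ e := by have := Nat.one_le_two_pow (n := e); omega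
      _ = 2 ^ (e + 1) := by ring
      _ ≤ _ := Nat.pow_le_pow_right (by norm_num) he
  rw [← hX]
  refine ⟨?_, key hlt.le (by omega), key Nat.lt_two_pow_self.le (by omega), ?_, ?_, ?_⟩
  -- Here the exponent is at least 12, because `2 ^ w` is at least 2.
  · calc 4096 = 2 ^ 12 := rfl
      _ ≤ _ := Nat.pow_le_pow_right (by norm_num) (by omega)
  · exact key (e := w + w) (by rw [pow_add]) (by omega)
  -- From `2 ^ w + 1 ≤ 2 ^ (w + 1)`, raised to the power `2 ^ w`.
  · refine key (e := w + (w + (w + 1) * 2 ^ w)) ?_ ?_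
    · rw [keyCount, pow_add, pow_add, pow_mul]
      gcongr
      rw [pow_succ]
      omega
    · rw [Nat.succ_mul]
      omega
  · exact key le_rfl (by omega)

end Bounds

end ODD

namespace ODD
open Prog

/-! ### The four algorithms -/

section Final

variable {m wt : Expr} {α : Type*} [Fintype α] [LinearOrder α] {w k : ℕ}
  {stp : Layer α w → ℕ → ℕ} {l D : List (Layer α w)} {S : Set (Layer α w)} {W t : ℕ}

theorem outputsWithin_of_minimizer {μ : List (Layer α w) → ℕ} {T T' : ℕ}
    (hs : ∀ L, Monotone (stp L)) (hμ : ∀ c, IsODD c → weight stp c = μ c)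
    (hk : 0 < k) (hD : D ∈ oddsOfLength Set.univ k) (hl : Presents l S)
    (h : ∃ D' ∈ oddsOfLength S k, lang D' = lang D)
    (hP : Within (prog optimum wt) [encodeInput D l] optimum
      (encodeLayers ((solution stp l D).getD [])) T) (hT : T ≤ T') :
    ∃ D', IsMinimizer μ S D D' ∧
      (prog optimum wt).OutputsWithin (encodeInput D l) (encodeLayers D') T' := by
  rcases solution_spec hs hk hD hl with ⟨-, c, hc, -, hmin⟩ | ⟨hn, -⟩
  · exact ⟨c, hmin.congr hμ, hP.conv (by rw [hc, Option.getD_some]) hT⟩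
  · exact absurd h hn

variable [Nonempty α]

theorem within_optimum_pow (hw : 0 < w) (hk : 0 < k) (hD : D ∈ oddsOfLength Set.univ k)
    (hl : Presents l S) (ht : Weighs (prog m wt) stp W t)
    (hW : ∀ x : List (Layer α w), x.length ≤ k → weight stp x ≤ W)
    (htW : t ≤ (2 ^ (6 * (Fintype.card α * w * 2 ^ w))) ^ 5 * (W + 1)) :
    Within (prog m wt) [encodeInput D l] optimum (encodeLayers ((solution stp l D).getD []))
      ((2 ^ (6 * (Fintype.card α * w * 2 ^ w))) ^ 13 * ((W + 1) * k)) := by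
  obtain ⟨h₁, h₂, h₃, h₄, h₅, h₆⟩ := parameters_le (Fintype.card α) Fintype.card_pos hw
  obtain ⟨hO, rfl, -⟩ := hD
  exact (within_optimum ht hO.ne_nil (fun i h => hO.finFlag i h) hW).conv rfl
    (tOptimum_le h₁ h₂ h₃ h₄ h₅
      ((Nat.add_le_add_right (length_layers_le hl.1) 1).trans h₆) htW hk)

theorem within_width (hw : 0 < w) (hk : 0 < k) (hD : D ∈ oddsOfLength Set.univ k)
    (hl : Presents l S) :
    Within (prog m widthBody) [encodeInput D l] optimum
      (encodeLayers ((solution widthStep l D).getD []))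
      (2 ^ (84 * (Fintype.card α * w * 2 ^ w)) * k) := by
  obtain ⟨h₁, h₂, -⟩ := parameters_le (Fintype.card α) Fintype.card_pos hw
  refine (within_optimum_pow hw hk hD hl (weighs_widthStep w) (fun x _ => weight_widthStep_le x)
    ?_).conv rfl ?_
  · generalize 2 ^ (6 * (Fintype.card α * w * 2 ^ w)) = B at h₁ h₂
    calc 100 * (w + 1) + 20 * w + 200 ≤ B * (w + 1) := by nlinarith
      _ ≤ B ^ 5 * (w + 1) := Nat.mul_le_mul_right _ (Nat.le_self_pow (by norm_num) B)
  -- The weight bound `w` does not grow with `k` and costs one more factor: 84 = 6 * (13 + 1).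
  · calc _ ≤ (2 ^ (6 * (Fintype.card α * w * 2 ^ w))) ^ 13 *
          (2 ^ (6 * (Fintype.card α * w * 2 ^ w)) * k) := by gcongr
      _ = _ := by rw [← pow_mul, ← mul_assoc, ← pow_add]; congr 2; ring

end Final

/-- The minimizing program also decides: a solution is nonempty and hence encoded by a cell, while
its absence yields `.nil`. The choice of weight does not matter here. -/
theorem exists_program_decide :
    ∃ (P : Program) (c : ℕ),
      ∀ (α : Type u) [Fintype α] [LinearOrder α] [Nonempty α] (w k : ℕ), 0 < w → 0 < k →
      ∀ D ∈ oddsOfLength (Set.univ : Set (Layer α w)) k,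
      ∀ (S : Set (Layer α w)) (l : List (Layer α w)), Presents l S →
      ∃ b : Bool, (b = true ↔ ∃ D' ∈ oddsOfLength S k, lang D' = lang D) ∧
        P.OutputsWithin (encodeInput D l) (.ofBool b)
          (2 ^ (c * (Fintype.card α * w * 2 ^ w)) * k) := by
  refine ⟨prog (.ite optimum one .nil) widthBody, 90, ?_⟩
  intro α _ _ _ w k hw hk D hD S l hl
  have h := within_width (m := .ite optimum one .nil) hw hk hD hl
  obtain ⟨h₁, -⟩ := parameters_le (Fintype.card α) Fintype.card_pos hw
  -- The increase from 84 to 90 pays for the final test.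
  have hT : 2 ^ (84 * (Fintype.card α * w * 2 ^ w)) * k + 3 + 1 ≤
      2 ^ (90 * (Fintype.card α * w * 2 ^ w)) * k := by
    generalize Fintype.card α * w * 2 ^ w = X at h₁ ⊢
    rw [show 90 * X = 6 * X + 84 * X by ring, pow_add, mul_assoc]
    have h' : 0 < 2 ^ (84 * X) * k := by positivity
    have := Nat.mul_le_mul_right (2 ^ (84 * X) * k) h₁
    omega
  rcases solution_spec monotone_widthStep hk hD hl with ⟨hex, c, hc, hne, -⟩ | ⟨hn, hc⟩
  · refine ⟨true, by simpa using hex, ?_⟩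
    rw [hc] at h
    obtain ⟨L, c, rfl⟩ := List.exists_cons_of_ne_nil hne
    exact (Within.iteCons h rfl .one).conv rfl hT
  · refine ⟨false, by simpa using hn, ?_⟩
    rw [hc] at h
    exact (Within.iteNil h rfl .nil).conv rfl (by omega)

theorem exists_program_width :
    ∃ (P : Program) (c : ℕ),
      ∀ (α : Type u) [Fintype α] [LinearOrder α] [Nonempty α] (w k : ℕ), 0 < w → 0 < k →
      ∀ D ∈ oddsOfLength (Set.univ : Set (Layer α w)) k,
      ∀ (S : Set (Layer α w)) (l : List (Layer α w)), Presents l S →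
      (∃ D' ∈ oddsOfLength S k, lang D' = lang D) →
      ∃ D', IsMinimizer width S D D' ∧
        P.OutputsWithin (encodeInput D l) (encodeLayers D')
          (2 ^ (c * (Fintype.card α * w * 2 ^ w)) * k) := by
  refine ⟨prog optimum widthBody, 84, ?_⟩
  intro α _ _ _ w k hw hk D hD S l hl hex
  exact outputsWithin_of_minimizer monotone_widthStep (fun c hc => weight_widthStep hc.frontier)
    hk hD hl hex (within_width hw hk hD hl) le_rfl

/-- A weight bound linear in `k` gives the second factor `k`, and 96 = 6 * (13 + 3). The logarithm
enters only through being at least 1. -/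
theorem le_mul_sq_log {X W k : ℕ} (hk : 0 < k) (hW : W + 1 ≤ (2 ^ (6 * X)) ^ 3 * k) :
    (2 ^ (6 * X)) ^ 13 * ((W + 1) * k) ≤ 2 ^ (96 * X) * (k ^ 2 * Nat.log 2 (k + 1)) := by
  have hlog : 1 ≤ Nat.log 2 (k + 1) := Nat.log_pos (by norm_num) (by omega)
  calc _ ≤ (2 ^ (6 * X)) ^ 13 * ((2 ^ (6 * X)) ^ 3 * k * k) := by gcongr
    _ = 2 ^ (96 * X) * (k ^ 2 * 1) := by
      rw [← pow_mul, ← pow_mul, mul_assoc (2 ^ (6 * X * 3)), ← mul_assoc, ← pow_add,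
        show 6 * X * 13 + 6 * X * 3 = 96 * X by ring]
      ring
    _ ≤ _ := by gcongr

theorem exists_program_numStates :
    ∃ (P : Program) (c : ℕ),
      ∀ (α : Type u) [Fintype α] [LinearOrder α] [Nonempty α] (w k : ℕ), 0 < w → 0 < k →
      ∀ D ∈ oddsOfLength (Set.univ : Set (Layer α w)) k,
      ∀ (S : Set (Layer α w)) (l : List (Layer α w)), Presents l S →
      (∃ D' ∈ oddsOfLength S k, lang D' = lang D) →
      ∃ D', IsMinimizer numStates S D D' ∧
        P.OutputsWithin (encodeInput D l) (encodeLayers D')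
          (2 ^ (c * (Fintype.card α * w * 2 ^ w)) * (k ^ 2 * Nat.log 2 (k + 1))) := by
  refine ⟨prog optimum stateBody, 96, ?_⟩
  intro α _ _ _ w k hw hk D hD S l hl hex
  obtain ⟨h₁, h₂, -⟩ := parameters_le (Fintype.card α) Fintype.card_pos hw
  refine outputsWithin_of_minimizer monotone_stateStep (fun c hc => weight_stateStep hc)
    hk hD hl hex (within_optimum_pow hw hk hD hl (weighs_stateStep (2 * w * k))
      (fun x hx => weight_le stateStep_le hx) ?_) (le_mul_sq_log hk ?_)
  · generalize 2 ^ (6 * (Fintype.card α * w * 2 ^ w)) = B at h₁ h₂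
    calc 100 * (w + 1) + 200 ≤ B ^ 2 * 1 := by nlinarith
      _ ≤ B ^ 5 * (2 * w * k + 1) :=
        Nat.mul_le_mul (Nat.pow_le_pow_right (by omega) (by norm_num)) (by omega)
  · generalize 2 ^ (6 * (Fintype.card α * w * 2 ^ w)) = B at h₁ h₂
    calc 2 * w * k + 1 ≤ 2 * (w + 1) * k := by nlinarith
      _ ≤ B ^ 2 * k := Nat.mul_le_mul_right _ (by nlinarith)
      _ ≤ B ^ 3 * k := Nat.mul_le_mul_right _ (Nat.pow_le_pow_right (by omega) (by norm_num))

theorem exists_program_numTransitions :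
    ∃ (P : Program) (c : ℕ),
      ∀ (α : Type u) [Fintype α] [LinearOrder α] [Nonempty α] (w k : ℕ), 0 < w → 0 < k →
      ∀ D ∈ oddsOfLength (Set.univ : Set (Layer α w)) k,
      ∀ (S : Set (Layer α w)) (l : List (Layer α w)), Presents l S →
      (∃ D' ∈ oddsOfLength S k, lang D' = lang D) →
      ∃ D', IsMinimizer numTransitions S D D' ∧
        P.OutputsWithin (encodeInput D l) (encodeLayers D')
          (2 ^ (c * (Fintype.card α * w * 2 ^ w)) * (k ^ 2 * Nat.log 2 (k + 1))) := by
  refine ⟨prog optimum transitionBody, 96, ?_⟩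
  intro α _ _ _ w k hw hk D hD S l hl hex
  obtain ⟨h₁, h₂, h₃, -⟩ := parameters_le (Fintype.card α) Fintype.card_pos hw
  refine outputsWithin_of_minimizer monotone_transitionStep (fun c _ => weight_transitionStep c)
    hk hD hl hex (within_optimum_pow hw hk hD hl
      (weighs_transitionStep (w * (Fintype.card α * w) * k))
      (fun x hx => weight_le transitionStep_le hx) ?_) (le_mul_sq_log hk ?_)
  · generalize 2 ^ (6 * (Fintype.card α * w * 2 ^ w)) = B at h₁ h₂ h₃
    have h₄ : 20 * (w + 1) + 20 ≤ B ^ 2 := by nlinarith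
    have h₅ := Nat.mul_le_mul h₄ h₃
    have h₆ : (20 * (w + 1) + 20) * (Fintype.card α + 1) + 20 ≤ 2 * B ^ 3 := by nlinarith
    have h₇ := Nat.mul_le_mul h₆ h₂
    have h₈ : 3 * B ^ 4 ≤ B ^ 5 := by
      rw [pow_succ B 4, mul_comm]
      exact Nat.mul_le_mul_left _ (by omega)
    have h₉ : B ≤ B ^ 4 := Nat.le_self_pow (by norm_num) B
    have h₀ : B ^ 5 ≤ B ^ 5 * (w * (Fintype.card α * w) * k + 1) :=
      Nat.le_mul_of_pos_right _ (by omega)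
    have : 2 * B ^ 3 * B = 2 * B ^ 4 := by ring
    omega
  · generalize 2 ^ (6 * (Fintype.card α * w * 2 ^ w)) = B at h₁ h₂ h₃
    calc w * (Fintype.card α * w) * k + 1 ≤ (w * (Fintype.card α * w) + 1) * k := by
          rw [Nat.succ_mul]
          omega
      _ ≤ ((w + 1) * ((Fintype.card α + 1) * (w + 1))) * k :=
        Nat.mul_le_mul_right _ (by nlinarith [Nat.zero_le (w * (Fintype.card α * w))])
      _ ≤ (B * (B * B)) * k := by gcongr
      _ = B ^ 3 * k := by ring

end ODD

theorem theorem5p4 :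
    -- deciding whether there is a diagram with layers in `S` and the same language
    (∃ (P : ODD.Program) (c : ℕ),
      ∀ (α : Type u) [Fintype α] [LinearOrder α] [Nonempty α] (w k : ℕ), 0 < w → 0 < k →
      ∀ D ∈ ODD.oddsOfLength (Set.univ : Set (ODD.Layer α w)) k,
      ∀ (S : Set (ODD.Layer α w)) (l : List (ODD.Layer α w)), ODD.Presents l S →
      ∃ b : Bool, (b = true ↔ ∃ D' ∈ ODD.oddsOfLength S k, ODD.lang D' = ODD.lang D) ∧
        P.OutputsWithin (ODD.encodeInput D l) (.ofBool b)
          (2 ^ (c * (Fintype.card α * w * 2 ^ w)) * k)) ∧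
    -- minimum width
    (∃ (P : ODD.Program) (c : ℕ),
      ∀ (α : Type u) [Fintype α] [LinearOrder α] [Nonempty α] (w k : ℕ), 0 < w → 0 < k →
      ∀ D ∈ ODD.oddsOfLength (Set.univ : Set (ODD.Layer α w)) k,
      ∀ (S : Set (ODD.Layer α w)) (l : List (ODD.Layer α w)), ODD.Presents l S →
      (∃ D' ∈ ODD.oddsOfLength S k, ODD.lang D' = ODD.lang D) →
      ∃ D', ODD.IsMinimizer ODD.width S D D' ∧
        P.OutputsWithin (ODD.encodeInput D l) (ODD.encodeLayers D')
          (2 ^ (c * (Fintype.card α * w * 2 ^ w)) * k)) ∧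
    -- minimum number of states
    (∃ (P : ODD.Program) (c : ℕ),
      ∀ (α : Type u) [Fintype α] [LinearOrder α] [Nonempty α] (w k : ℕ), 0 < w → 0 < k →
      ∀ D ∈ ODD.oddsOfLength (Set.univ : Set (ODD.Layer α w)) k,
      ∀ (S : Set (ODD.Layer α w)) (l : List (ODD.Layer α w)), ODD.Presents l S →
      (∃ D' ∈ ODD.oddsOfLength S k, ODD.lang D' = ODD.lang D) →
      ∃ D', ODD.IsMinimizer ODD.numStates S D D' ∧
        P.OutputsWithin (ODD.encodeInput D l) (ODD.encodeLayers D')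
          (2 ^ (c * (Fintype.card α * w * 2 ^ w)) * (k ^ 2 * Nat.log 2 (k + 1)))) ∧
    -- minimum number of transitions
    (∃ (P : ODD.Program) (c : ℕ),
      ∀ (α : Type u) [Fintype α] [LinearOrder α] [Nonempty α] (w k : ℕ), 0 < w → 0 < k →
      ∀ D ∈ ODD.oddsOfLength (Set.univ : Set (ODD.Layer α w)) k,
      ∀ (S : Set (ODD.Layer α w)) (l : List (ODD.Layer α w)), ODD.Presents l S →
      (∃ D' ∈ ODD.oddsOfLength S k, ODD.lang D' = ODD.lang D) →
      ∃ D', ODD.IsMinimizer ODD.numTransitions S D D' ∧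
        P.OutputsWithin (ODD.encodeInput D l) (ODD.encodeLayers D')
          (2 ^ (c * (Fintype.card α * w * 2 ^ w)) * (k ^ 2 * Nat.log 2 (k + 1)))) := by
  exact ⟨ODD.exists_program_decide, ODD.exists_program_width, ODD.exists_program_numStates,
    ODD.exists_program_numTransitions⟩
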